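/- Let $A$ be a (not necessarily unital) $C^*$-algebra with multiplier algebra $M(A)$, and let $\alpha:\mathbb N\to\operatorname{End}(A)$ be an action of the additive monoid $\mathbb N=\{0,1,2,\dots\}$ by $*$-endomorphisms ($\alpha_0=\mathrm{id}$, $\alpha_{m+n}=\alpha_m\circ\alpha_n$). Assume that every $\alpha_n$ is injective, is extendible (it extends to an endomorphism $\overline{\alpha_n}$ of $M(A)$ such that $p_n:=\overline{\alpha_n}(1)$ is the strict limit of $\alpha_n(u_\lambda)$ for some approximate unit $(u_\lambda)$ of $A$), and has hereditary range ($0\le a\le \alpha_n(b)$ implies $a\in\alpha_n(A)$). Put $L_n(a):=\alpha_n^{-1}(p_n a p_n)$ for $a\in A$, and let $X_n$ be the Hilbert bimodule over $A$ obtained from $A p_n$, with $$x\cdot a=x\alpha_n(a),\qquad \langle x,y\rangle_n=L_n(x^*y),\qquad \phi_n(a)x=ax ,$$ by completion (here $Ap_n$ is already complete). With the multiplication $(m,x)(n,y)=(m+n,\,x\alpha_m(y))$, the disjoint union $X_{\mathbb N}=\bigsqcup_n X_n$ is a product system over $\mathbb N$ with $X_0=A$. Let $K_n:=\overline{\operatorname{span}}\,A\alpha_n(A)A$,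 a closed ideal of $A$ contained in $\phi_n^{-1}(\mathcal K(X_n))$. A Toeplitz representation of a Hilbert bimodule $E$ over $A$, with left action $\phi$, in a $C^*$-algebra $B$ is a pair $(\psi,\pi)$ of a linear map $\psi:E\to B$ and a $*$-homomorphism $\pi:A\to B$ with $\psi(x\cdot a)=\psi(x)\pi(a)$, $\psi(x)^*\psi(y)=\pi(\langle x,y\rangle)$ and $\psi(a\cdot x)=\pi(a)\psi(x)$. It is coisometric on an ideal $K\subseteq\phi^{-1}(\mathcal K(E))$ if $\psi^{(1)}(\phi(a))=\pi(a)$ for all $a\in K$, where $\psi^{(1)}:\mathcal K(E)\to B$ is the homomorphism with $\psi^{(1)}(\theta_{x,y})=\psi(x)\psi(y)^*$. A Toeplitz representation of $X_{\mathbb N}$ is a map $\psi:X_{\mathbb N}\to B$ with $\psi(u)\psi(v)=\psi(uv)$ such that, with $\psi_n:=\psi|_{X_n}$, each $(\psi_n,\psi_0)$ is a Toeplitz representation of $X_n$; it is coisometric on $(K_n)_n$ if each $(\psi_n,\psi_0)$ is coisometric on $K_n$. The relative Cuntz–Pimsner algebras $\mathcal O(X_{\mathbb N},(K_n)_n)$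 and $\mathcal O(X_1,K_1)$ are the $C^*$-algebras generated by the universal Toeplitz representation $j$ of $X_{\mathbb N}$ coisometric on $(K_n)_n$, and by the universal Toeplitz representation $(k_1,k_A)$ of $X_1$ coisometric on $K_1$, respectively. Then $\mathcal O(X_{\mathbb N},(K_n)_n)$ is isomorphic to $\mathcal O(X_1,K_1)$, by a $*$-isomorphism $\Phi$ with $\Phi(j(1,x))=k_1(x)$ for all $x\in X_1$ and $\Phi(j(0,a))=k_A(a)$ for all $a\in A$. -/

import Mathlib

universe u v w

noncomputable section

namespace RelCP

open scoped MultiplierAlgebra ENNReal Topology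
open Filter

/-! ### Hilbert bimodules -/

/-- A Hilbert bimodule over a C⋆-algebra `A`: a right Hilbert `A`-module (complete, with right
action `right x a = x · a` and `A`-valued inner product, linear in the second variable) together
with a homomorphism `left` from `A` to its adjointable operators.  (Mathlib's `CStarModule` is not
used, because its inner product is compatible with a left action of `A`.) -/
structure HilbertBimodule (A : Type u) [NonUnitalCStarAlgebra A] where
  carrier : Type u
  [normedAddCommGroup : NormedAddCommGroup carrier]
  [normedSpace : NormedSpace ℂ carrier]
  [completeSpace : CompleteSpace carrier]
  right : carrier →ₗ[ℂ] A →ₗ[ℂ] carrier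
  right_mul : ∀ x a b, right x (a * b) = right (right x a) b
  inner : carrier → carrier → A
  inner_add_right : ∀ x y z, inner x (y + z) = inner x y + inner x z
  inner_smul_right : ∀ (c : ℂ) x y, inner x (c • y) = c • inner x y
  inner_right : ∀ x y a, inner x (right y a) = inner x y * a
  star_inner : ∀ x y, star (inner x y) = inner y x
  inner_self_nonneg : ∀ x, ∃ b, inner x x = star b * b
  norm_sq : ∀ x, ‖x‖ ^ 2 = ‖inner x x‖
  left : A →ₙₐ[ℂ] (carrier →L[ℂ] carrier)
  inner_left : ∀ a x y, inner (left a x) y = inner x (left (star a) y)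

attribute [instance] HilbertBimodule.normedAddCommGroup HilbertBimodule.normedSpace
  HilbertBimodule.completeSpace

instance {A : Type u} [NonUnitalCStarAlgebra A] : CoeSort (HilbertBimodule A) (Type u) :=
  ⟨HilbertBimodule.carrier⟩

namespace HilbertBimodule

variable {A : Type u} [NonUnitalCStarAlgebra A] (E : HilbertBimodule A)

theorem inner_add_left (x y z : E) : E.inner (x + y) z = E.inner x z + E.inner y z := by
  rw [← E.star_inner z, E.inner_add_right, star_add, E.star_inner, E.star_inner]

theorem inner_right_left (x y : E) (a : A) : E.inner (E.right x a) y = star a * E.inner x y := by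
  rw [← E.star_inner y, E.inner_right, star_mul, E.star_inner]

theorem norm_inner_le (x y : E) : ‖E.inner x y‖ ≤ ‖x‖ * ‖y‖ := by
  let : PartialOrder Aᵐᵒᵖ := CStarAlgebra.spectralOrder Aᵐᵒᵖ
  have : StarOrderedRing Aᵐᵒᵖ := CStarAlgebra.spectralOrderedRing Aᵐᵒᵖ
  let : SMul Aᵐᵒᵖ E := ⟨fun a x => E.right x a.unop⟩
  let : CStarModule Aᵐᵒᵖ E :=
    { inner := fun x y => MulOpposite.op (E.inner x y)
      inner_add_right := fun {x y z} => by simp [E.inner_add_right]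
      inner_self_nonneg := fun {x} => by
        obtain ⟨b, hb⟩ := E.inner_self_nonneg x
        rw [hb, MulOpposite.op_mul, MulOpposite.op_star]
        exact mul_star_self_nonneg _
      inner_self := fun {x} => by
        rw [MulOpposite.op_eq_zero_iff, ← norm_eq_zero, ← E.norm_sq]
        simp
      inner_op_smul_right := fun {a x y} => by
        change MulOpposite.op (E.inner x (E.right y a.unop)) = _
        rw [E.inner_right, MulOpposite.op_mul, MulOpposite.op_unop]
      inner_smul_right_complex := fun {z x y} => by simp [E.inner_smul_right]
      star_inner := fun x y => by rw [← MulOpposite.op_star, E.star_inner]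
      norm_eq_sqrt_norm_inner_self := fun x => by
        rw [MulOpposite.norm_op, ← E.norm_sq, Real.sqrt_sq (norm_nonneg _)] }
  exact CStarModule.norm_inner_le (A := Aᵐᵒᵖ) E.carrier (x := x) (y := y)

theorem norm_right_le (x : E) (a : A) : ‖E.right x a‖ ≤ ‖x‖ * ‖a‖ := by
  refine (pow_le_pow_iff_left₀ (norm_nonneg _) (by positivity) two_ne_zero).mp ?_
  rw [E.norm_sq, E.inner_right, E.inner_right_left]
  calc ‖star a * E.inner x x * a‖ ≤ ‖star a‖ * ‖E.inner x x‖ * ‖a‖ := by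
        refine (norm_mul_le _ _).trans ?_
        gcongr
        exact norm_mul_le _ _
    _ = (‖x‖ * ‖a‖) ^ 2 := by rw [norm_star, ← E.norm_sq]; ring

/-- The rank-one operator `θ_{x,y} : z ↦ x · ⟨y, z⟩`. -/
def theta (x y : E) : E →L[ℂ] E :=
  LinearMap.mkContinuous
    { toFun := fun z => E.right x (E.inner y z)
      map_add' := fun z z' => by rw [E.inner_add_right, map_add]
      map_smul' := fun c z => by rw [E.inner_smul_right, map_smul, RingHom.id_apply] }
    (‖x‖ * ‖y‖) fun z => (E.norm_right_le x _).trans <| by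
      rw [mul_assoc]
      gcongr
      exact E.norm_inner_le y z

@[simp]
theorem theta_apply (x y z : E) : E.theta x y z = E.right x (E.inner y z) := rfl

/-- The compact operators `𝒦(E)`: the closed linear span of the rank-one operators. -/
def compacts : Submodule ℂ (E →L[ℂ] E) :=
  (Submodule.span ℂ {T | ∃ x y, T = E.theta x y}).topologicalClosure

theorem theta_mem_compacts (x y : E) : E.theta x y ∈ E.compacts :=
  Submodule.le_topologicalClosure _ (Submodule.subset_span ⟨x, y, rfl⟩)

/-- A closed two-sided ideal of `A` contained in `φ⁻¹(𝒦(E))`, where `φ` is the left action. -/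
structure CompactIdeal where
  carrier : Submodule ℂ A
  isClosed : IsClosed (carrier : Set A)
  mul_mem_left : ∀ a b, b ∈ carrier → a * b ∈ carrier
  mul_mem_right : ∀ a b, b ∈ carrier → b * a ∈ carrier
  left_mem_compacts : ∀ a ∈ carrier, E.left a ∈ E.compacts

/-- A Toeplitz representation `(ψ, π)` of the Hilbert bimodule `E` in a C⋆-algebra `B`. -/
@[ext]
structure ToeplitzRep (B : Type v) [NonUnitalCStarAlgebra B] where
  toLin : E →ₗ[ℂ] B
  hom : A →⋆ₙₐ[ℂ] B
  map_right : ∀ x a, toLin (E.right x a) = toLin x * hom a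
  map_inner : ∀ x y, star (toLin x) * toLin y = hom (E.inner x y)
  map_left : ∀ a x, toLin (E.left a x) = hom a * toLin x

namespace ToeplitzRep

variable {E} {B : Type v} [NonUnitalCStarAlgebra B] (ψ : E.ToeplitzRep B)

theorem norm_toLin_le (x : E) : ‖ψ.toLin x‖ ≤ ‖x‖ := by
  refine (pow_le_pow_iff_left₀ (norm_nonneg _) (norm_nonneg _) two_ne_zero).mp ?_
  rw [sq, ← CStarRing.norm_star_mul_self, ψ.map_inner, E.norm_sq]
  exact NonUnitalStarAlgHom.norm_apply_le ψ.hom _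

/-- The span of the pairs `(θ_{x,y}, ψ(x) ψ(y)⋆)`. -/
def graph : Submodule ℂ ((E →L[ℂ] E) × B) :=
  Submodule.span ℂ {p | ∃ x y, p = (E.theta x y, ψ.toLin x * star (ψ.toLin y))}

theorem graph_mul (p : (E →L[ℂ] E) × B) (hp : p ∈ ψ.graph) (x : E) :
    p.2 * ψ.toLin x = ψ.toLin (p.1 x) := by
  induction hp using Submodule.span_induction with
  | mem p hp =>
    obtain ⟨y, z, rfl⟩ := hp
    simp only [theta_apply]
    rw [mul_assoc, ψ.map_inner, ψ.map_right]
  | zero => simp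
  | add p q _ _ hp hq => simp [add_mul, hp, hq]
  | smul c p _ hp => simp [smul_mul_assoc, hp]

theorem graph_adjoint (p : (E →L[ℂ] E) × B) (hp : p ∈ ψ.graph) :
    ∃ q ∈ ψ.graph, q.2 = star p.2 ∧ ∀ x y, E.inner (p.1 x) y = E.inner x (q.1 y) := by
  induction hp using Submodule.span_induction with
  | mem p hp =>
    obtain ⟨y, z, rfl⟩ := hp
    refine ⟨(E.theta z y, ψ.toLin z * star (ψ.toLin y)), Submodule.subset_span ⟨z, y, rfl⟩, ?_, ?_⟩
    · simp
    · intro x x'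
      simp only [theta_apply]
      rw [E.inner_right, E.inner_right_left, E.star_inner]
  | zero =>
    refine ⟨0, zero_mem _, by simp, fun x y => ?_⟩
    have h1 : E.inner x 0 = 0 := by simpa using E.inner_smul_right 0 x 0
    have h2 : E.inner 0 y = 0 := by
      rw [← E.star_inner]; simpa using E.inner_smul_right 0 y 0
    simp [h1, h2]
  | add p q _ _ hp hq =>
    obtain ⟨p', hp', h1, h2⟩ := hp
    obtain ⟨q', hq', h3, h4⟩ := hq
    exact ⟨p' + q', add_mem hp' hq', by simp [h1, h3], fun x y => by
      simp [E.inner_add_left, E.inner_add_right, h2, h4]⟩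
  | smul c p _ hp =>
    obtain ⟨p', hp', h1, h2⟩ := hp
    refine ⟨star c • p', Submodule.smul_mem _ _ hp', by simp [h1], fun x y => ?_⟩
    have h3 := E.inner_smul_right c y (p.1 x)
    have h4 := congrArg star h3
    rw [star_smul, E.star_inner, E.star_inner, h2] at h4
    simp only [Prod.smul_fst, smul_apply, E.inner_smul_right]
    exact h4

theorem exists_bound (p : (E →L[ℂ] E) × B) (hp : p ∈ ψ.graph) :
    ∃ M : ℝ, ∀ (P : E →L[ℂ] E) (b : B), (∀ x, b * ψ.toLin x = ψ.toLin (P x)) →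
      ‖b * p.2‖ ≤ M * ‖P‖ := by
  induction hp using Submodule.span_induction with
  | mem p hp =>
    obtain ⟨y, z, rfl⟩ := hp
    refine ⟨‖y‖ * ‖z‖, fun P b h => ?_⟩
    simp only
    rw [← mul_assoc, h]
    calc ‖ψ.toLin (P y) * star (ψ.toLin z)‖ ≤ ‖ψ.toLin (P y)‖ * ‖ψ.toLin z‖ := by
          simpa using norm_mul_le (ψ.toLin (P y)) (star (ψ.toLin z))
      _ ≤ (‖P‖ * ‖y‖) * ‖z‖ := by
          gcongr
          · exact (ψ.norm_toLin_le _).trans (P.le_opNorm y)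
          · exact ψ.norm_toLin_le _
      _ = _ := by ring
  | zero => exact ⟨0, fun P b _ => by simp⟩
  | add p q _ _ hp hq =>
    obtain ⟨M, hM⟩ := hp
    obtain ⟨N, hN⟩ := hq
    refine ⟨M + N, fun P b h => ?_⟩
    rw [Prod.snd_add, mul_add, add_mul]
    exact (norm_add_le _ _).trans (add_le_add (hM P b h) (hN P b h))
  | smul c p _ hp =>
    obtain ⟨M, hM⟩ := hp
    refine ⟨‖c‖ * M, fun P b h => ?_⟩
    rw [Prod.smul_snd, mul_smul_comm, norm_smul, mul_assoc]
    gcongr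
    exact hM P b h

theorem le_of_forall_pow_le {a r C : ℝ} (hr : 0 ≤ r)
    (h : ∀ k : ℕ, ∃ n, k ≤ n ∧ a ^ (n + 1) ≤ C * r ^ n) : a ≤ r := by
  by_contra! hlt
  have ha' : 0 < a := hr.trans_lt hlt
  have h1 : Tendsto (fun n : ℕ => C * (r / a) ^ n) atTop (𝓝 (C * 0)) :=
    (tendsto_pow_atTop_nhds_zero_of_lt_one (by positivity)
      ((div_lt_one ha').2 hlt)).const_mul C
  rw [mul_zero] at h1
  obtain ⟨k, hk⟩ := eventually_atTop.1 (h1.eventually (gt_mem_nhds ha'))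
  obtain ⟨n, hn, h2⟩ := h k
  have h3 := hk n hn
  rw [div_pow, ← mul_div_assoc, div_lt_iff₀ (by positivity)] at h3
  rw [pow_succ'] at h2
  linarith

theorem norm_graph_le (p : (E →L[ℂ] E) × B) (hp : p ∈ ψ.graph) : ‖p.2‖ ≤ ‖p.1‖ := by
  obtain ⟨q, hq, hq2, hadj⟩ := ψ.graph_adjoint p hp
  obtain ⟨M, hM⟩ := ψ.exists_bound p hp
  have hq1 : ‖q.1‖ ≤ ‖p.1‖ := by
    refine ContinuousLinearMap.opNorm_le_bound _ (norm_nonneg _) fun y => ?_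
    have h1 : ‖q.1 y‖ ^ 2 ≤ (‖p.1‖ * ‖y‖) * ‖q.1 y‖ := by
      rw [E.norm_sq, ← hadj]
      refine (E.norm_inner_le _ _).trans ?_
      calc ‖p.1 (q.1 y)‖ * ‖y‖ ≤ (‖p.1‖ * ‖q.1 y‖) * ‖y‖ := by
            gcongr
            exact p.1.le_opNorm _
        _ = _ := by ring
    rcases (norm_nonneg (q.1 y)).eq_or_lt with h | h
    · rw [← h]; positivity
    · rw [sq] at h1
      exact le_of_mul_le_mul_right h1 h
  let s : B := p.2 * star p.2
  let P : E →L[ℂ] E := p.1 * q.1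
  have hs : ∀ x, s * ψ.toLin x = ψ.toLin (P x) := fun x => by
    simp only [s, P]
    rw [mul_assoc, ← hq2, ψ.graph_mul q hq, ψ.graph_mul p hp]
    rfl
  obtain ⟨g, hg0, hgS⟩ : ∃ g : ℕ → B, g 0 = s ∧ ∀ n, g (n + 1) = s * g n :=
    ⟨fun n => Nat.rec s (fun _ b => s * b) n, rfl, fun _ => rfl⟩
  have hg : ∀ n, (Unitization.inr (g n) : Unitization ℂ B) = Unitization.inr s ^ (n + 1) := by
    intro n
    induction n with
    | zero => simp [hg0]
    | succ n ih =>
      rw [hgS, Unitization.inr_mul, ih, pow_succ' _ (n + 1)]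
  have hgψ : ∀ n x, g n * ψ.toLin x = ψ.toLin ((P ^ (n + 1)) x) := by
    intro n
    induction n with
    | zero => simpa [hg0] using hs
    | succ n ih =>
      intro x
      rw [hgS, mul_assoc, ih, hs, pow_succ' _ (n + 1)]
      rfl
  have hgs : ∀ n, g (n + 1) = g n * p.2 * star p.2 := by
    intro n
    have h : g n * p.2 * star p.2 = g n * s := mul_assoc _ _ _
    apply Unitization.inr_injective (R := ℂ)
    rw [h, Unitization.inr_mul, hg, hg, pow_succ]
  have hPr : ‖P‖ ≤ ‖p.1‖ * ‖p.1‖ :=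
    (norm_mul_le _ _).trans (by gcongr)
  have hbound : ∀ n, ‖g (n + 1)‖ ≤ (|M| * ‖p.2‖) * (‖p.1‖ * ‖p.1‖) ^ (n + 1) := by
    intro n
    rw [hgs]
    calc ‖g n * p.2 * star p.2‖ ≤ ‖g n * p.2‖ * ‖p.2‖ := by
          simpa using norm_mul_le (g n * p.2) (star p.2)
      _ ≤ (M * ‖P ^ (n + 1)‖) * ‖p.2‖ := by
          gcongr
          exact hM _ _ (hgψ n)
      _ ≤ (|M| * (‖p.1‖ * ‖p.1‖) ^ (n + 1)) * ‖p.2‖ := by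
          gcongr
          · exact le_abs_self M
          · exact (norm_pow_le' P n.succ_pos).trans (by gcongr)
      _ = _ := by ring
  have hsa : IsSelfAdjoint (Unitization.inr s : Unitization ℂ B) := by
    have : IsSelfAdjoint s := IsSelfAdjoint.mul_star_self _
    exact this.inr ℂ
  have key : ‖s‖ ≤ ‖p.1‖ * ‖p.1‖ := by
    refine le_of_forall_pow_le (C := |M| * ‖p.2‖) (by positivity) fun k => ?_
    have hk : k + 2 ≤ 2 ^ (k + 2) := (Nat.lt_two_pow_self).le
    obtain ⟨m, hm⟩ := Nat.exists_eq_add_of_le hk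
    refine ⟨k + m + 1, by omega, ?_⟩
    have h1 : ‖g (k + m + 1)‖ = ‖s‖ ^ (k + m + 1 + 1) := by
      have h2 : k + m + 1 + 1 = 2 ^ (k + 2) := by omega
      have e : ∀ b : B, ‖b‖ = ‖(Unitization.inr b : Unitization ℂ B)‖ := fun b =>
        (Unitization.norm_inr ..).symm
      rw [e, hg, h2, e]
      have := hsa.nnnorm_pow_two_pow (k + 2)
      exact congrArg NNReal.toReal this
    rw [← h1]
    exact hbound (k + m)
  have h3 : ‖s‖ = ‖p.2‖ * ‖p.2‖ := CStarRing.norm_self_mul_star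
  rw [h3] at key
  exact (mul_self_le_mul_self_iff (norm_nonneg _) (norm_nonneg _)).2 key

/-- The closure of `graph` projects isometrically to the first coordinate. -/
def graphIso : ψ.graph.topologicalClosure →ₗᵢ[ℂ] (E →L[ℂ] E) where
  toLinearMap := LinearMap.fst ℂ _ _ ∘ₗ ψ.graph.topologicalClosure.subtype
  norm_map' p := by
    have h : ∀ q ∈ closure (ψ.graph : Set ((E →L[ℂ] E) × B)), ‖q.2‖ ≤ ‖q.1‖ := fun q hq =>
      closure_minimal (s := (ψ.graph : Set ((E →L[ℂ] E) × B))) (t := {q | ‖q.2‖ ≤ ‖q.1‖})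
        (fun q hq => ψ.norm_graph_le q hq)
        (isClosed_le (by fun_prop) (by fun_prop)) hq
    exact (max_eq_left (h p.1 p.2)).symm

theorem compacts_le_range :
    E.compacts ≤ LinearMap.range ψ.graphIso.toLinearMap := by
  refine Submodule.topologicalClosure_minimal _ (Submodule.span_le.2 ?_) ?_
  · rintro _ ⟨x, y, rfl⟩
    exact ⟨⟨(E.theta x y, ψ.toLin x * star (ψ.toLin y)),
      Submodule.le_topologicalClosure _ (Submodule.subset_span ⟨x, y, rfl⟩)⟩, rfl⟩
  · have : CompleteSpace ψ.graph.topologicalClosure :=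
      ψ.graph.isClosed_topologicalClosure.completeSpace_coe
    exact ψ.graphIso.isometry.isClosedEmbedding.isClosed_range

/-- The map `ψ⁽¹⁾ : 𝒦(E) → B`, the unique continuous linear map with
`ψ⁽¹⁾(θ_{x,y}) = ψ(x) ψ(y)⋆`. -/
def compactMap : E.compacts →L[ℂ] B :=
  (ContinuousLinearMap.snd ℂ _ _ ∘L ψ.graph.topologicalClosure.subtypeL) ∘L
    (ψ.graphIso.equivRange.symm.toContinuousLinearEquiv.toContinuousLinearMap ∘L
      (Submodule.inclusion ψ.compacts_le_range).mkContinuous 1 (fun x => by simp))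

theorem compactMap_eq_iff (T : E.compacts) (b : B) :
    ψ.compactMap T = b ↔ ((T : E →L[ℂ] E), b) ∈ ψ.graph.topologicalClosure := by
  obtain ⟨p, hp⟩ := ψ.compacts_le_range T.2
  have h1 : ∀ q : ψ.graph.topologicalClosure, ψ.graphIso q = (T : E →L[ℂ] E) →
      ψ.compactMap T = q.1.2 := by
    intro q hq
    have : Submodule.inclusion ψ.compacts_le_range T = ψ.graphIso.equivRange q :=
      Subtype.ext hq.symm
    change (ψ.graphIso.equivRange.symm (Submodule.inclusion ψ.compacts_le_range T)).1.2 = _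
    rw [this, LinearIsometryEquiv.symm_apply_apply]
  constructor
  · rintro rfl
    rw [h1 p hp]
    have hp' : p.1.1 = (T : E →L[ℂ] E) := hp
    rw [← hp']
    exact p.2
  · intro h
    exact h1 ⟨_, h⟩ rfl

theorem compactMap_theta (x y : E) :
    ψ.compactMap ⟨E.theta x y, E.theta_mem_compacts x y⟩ = ψ.toLin x * star (ψ.toLin y) :=
  (ψ.compactMap_eq_iff _ _).2
    (Submodule.le_topologicalClosure _ (Submodule.subset_span ⟨x, y, rfl⟩))

/-- `(ψ, π)` is coisometric on the ideal `K ⊆ φ⁻¹(𝒦(E))`: `ψ⁽¹⁾(φ(a)) = π(a)` for `a ∈ K`. -/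
def IsCoisometric (K : E.CompactIdeal) : Prop :=
  ∀ a (ha : a ∈ K.carrier), ψ.compactMap ⟨E.left a, K.left_mem_compacts a ha⟩ = ψ.hom a

variable {C : Type w} [NonUnitalCStarAlgebra C]

/-- The composition of a Toeplitz representation with a homomorphism. -/
def map (f : B →⋆ₙₐ[ℂ] C) : E.ToeplitzRep C where
  toLin := (f : B →ₗ[ℂ] C) ∘ₗ ψ.toLin
  hom := f.comp ψ.hom
  map_right x a := by simp [ψ.map_right]
  map_inner x y := by simp [← ψ.map_inner, map_star]
  map_left a x := by simp [ψ.map_left]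

theorem compactMap_map (f : B →⋆ₙₐ[ℂ] C) (T : E.compacts) :
    (ψ.map f).compactMap T = f (ψ.compactMap T) := by
  have hf : Continuous f :=
    AddMonoidHomClass.continuous_of_bound f 1 fun x => by
      simpa using NonUnitalStarAlgHom.norm_apply_le f x
  rw [compactMap_eq_iff]
  have h := (ψ.compactMap_eq_iff T _).1 rfl
  let F : ((E →L[ℂ] E) × B) →ₗ[ℂ] ((E →L[ℂ] E) × C) := LinearMap.prodMap LinearMap.id (f : B →ₗ[ℂ] C)
  have hF : Continuous F := continuous_fst.prodMk (hf.comp continuous_snd)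
  have h1 : ψ.graph ≤ (ψ.map f).graph.comap F := by
    refine Submodule.span_le.2 ?_
    rintro _ ⟨x, y, rfl⟩
    exact Submodule.subset_span ⟨x, y, by simp [F, map, map_star]⟩
  exact map_mem_closure (f := F) hF h fun p hp => h1 hp

end ToeplitzRep

end HilbertBimodule

/-! ### The C⋆-algebra generated by a family of elements of a product -/

section Product

variable {ι : Type v} {B : ι → Type w} [∀ i, NonUnitalCStarAlgebra (B i)]

/-- The element of the `ℓ^∞`-product with bounded coordinates `x i`. -/
def bddElem (x : ∀ i, B i) (c : ℝ) (h : ∀ i, ‖x i‖ ≤ c) : lp B ∞ :=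
  ⟨x, memℓp_infty ⟨c, by rintro _ ⟨i, rfl⟩; exact h i⟩⟩

/-- The `i`-th coordinate as a homomorphism on the `ℓ^∞`-product. -/
def coordHom (i : ι) : lp B ∞ →⋆ₙₐ[ℂ] B i where
  toFun x := x i
  map_smul' _ _ := rfl
  map_zero' := rfl
  map_add' _ _ := rfl
  map_mul' _ _ := rfl
  map_star' _ := rfl

/-- The C⋆-subalgebra of the `ℓ^∞`-product generated by a set. -/
def generated (G : Set (lp B ∞)) : NonUnitalStarSubalgebra ℂ (lp B ∞) :=
  (NonUnitalStarAlgebra.adjoin ℂ G).topologicalClosure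

instance (G : Set (lp B ∞)) : IsClosed (generated G : Set (lp B ∞)) :=
  NonUnitalStarSubalgebra.isClosed_topologicalClosure _

theorem subset_generated (G : Set (lp B ∞)) : G ⊆ generated G :=
  (NonUnitalStarAlgebra.subset_adjoin ℂ G).trans
    (NonUnitalStarSubalgebra.le_topologicalClosure _)

end Product

/-! ### Generated C⋆-algebras are small -/

section Small

/-- Expressions in the language of `⋆`-algebras. -/
inductive StarTerm (G : Type u) : Type u
  | gen (g : G)
  | zero
  | add (s t : StarTerm G)
  | mul (s t : StarTerm G)
  | smul (c : ℂ) (s : StarTerm G)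
  | star (s : StarTerm G)

variable {B : Type w} [NonUnitalCStarAlgebra B]

/-- Evaluation of expressions. -/
def StarTerm.eval {G : Type u} (f : G → B) : StarTerm G → B
  | .gen g => f g
  | .zero => 0
  | .add s t => s.eval f + t.eval f
  | .mul s t => s.eval f * t.eval f
  | .smul c s => c • s.eval f
  | .star s => Star.star (s.eval f)

theorem small_adjoin_closure {G : Type u} (f : G → B) :
    Small.{u} (NonUnitalStarAlgebra.adjoin ℂ (Set.range f)).topologicalClosure := by
  let R : NonUnitalStarSubalgebra ℂ B :=
    { carrier := Set.range (StarTerm.eval f)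
      add_mem' := by rintro _ _ ⟨s, rfl⟩ ⟨t, rfl⟩; exact ⟨.add s t, rfl⟩
      zero_mem' := ⟨.zero, rfl⟩
      mul_mem' := by rintro _ _ ⟨s, rfl⟩ ⟨t, rfl⟩; exact ⟨.mul s t, rfl⟩
      smul_mem' := by rintro c _ ⟨s, rfl⟩; exact ⟨.smul c s, rfl⟩
      star_mem' := by rintro _ ⟨s, rfl⟩; exact ⟨.star s, rfl⟩ }
  have hR : NonUnitalStarAlgebra.adjoin ℂ (Set.range f) ≤ R :=
    NonUnitalStarAlgebra.adjoin_le (by rintro _ ⟨g, rfl⟩; exact ⟨.gen g, rfl⟩)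
  let F : (ℕ → StarTerm G) → B := fun t => limUnder atTop fun n => (t n).eval f
  have hs : Small.{u} (Set.range F) := small_range F
  refine small_subset (s := Set.range F) fun b hb => ?_
  obtain ⟨x, hx, hxb⟩ := mem_closure_iff_seq_limit.1 hb
  choose t ht using fun n => hR (hx n)
  exact ⟨t, Tendsto.limUnder_eq (by simpa [ht] using hxb)⟩

theorem exists_small_cstar (C : Type w) [NonUnitalCStarAlgebra C] [Small.{u} C] :
    ∃ (D : Type u) (_ : NonUnitalCStarAlgebra D), Nonempty (D ≃⋆ₐ[ℂ] C) := by
  let e : Shrink.{u} C ≃ C := (equivShrink C).symm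
  let i1 : NonUnitalRing (Shrink.{u} C) := e.nonUnitalRing
  let i2 : Module ℂ (Shrink.{u} C) := e.module ℂ
  let f : Shrink.{u} C →ₙ+* C :=
    { toFun := e
      map_mul' := fun a b => e.apply_symm_apply _
      map_add' := fun a b => e.apply_symm_apply _
      map_zero' := e.apply_symm_apply _ }
  have hsmul : ∀ (c : ℂ) x, e (c • x) = c • e x := fun c x => e.apply_symm_apply _
  have hmul : ∀ x y, e (x * y) = e x * e y := fun x y => map_mul f x y
  have hadd : ∀ x y, e (x + y) = e x + e y := fun x y => map_add f x y
  let i3 : NonUnitalNormedRing (Shrink.{u} C) := NonUnitalNormedRing.induced _ C f e.injective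
  have hnorm : ∀ x, ‖x‖ = ‖e x‖ := fun x => rfl
  let i4 : NormedSpace ℂ (Shrink.{u} C) := { i2 with
    norm_smul_le := fun c x => by
      change ‖e (c • x)‖ ≤ ‖c‖ * ‖e x‖
      rw [hsmul]
      exact norm_smul_le _ _ }
  let i5 : StarRing (Shrink.{u} C) :=
    { star := fun x => e.symm (star (e x))
      star_involutive := fun x => by simp
      star_mul := fun x y => e.injective (by rw [hmul]; simp [hmul])
      star_add := fun x y => e.injective (by rw [hadd]; simp [hadd]) }
  have hstar : ∀ x, e (star x) = star (e x) := fun x => e.apply_symm_apply _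
  have hiso : Isometry e := AddMonoidHomClass.isometry_of_norm f fun x => rfl
  have i6 : CompleteSpace (Shrink.{u} C) :=
    (IsometryEquiv.mk e hiso).completeSpace
  have i7 : CStarRing (Shrink.{u} C) := ⟨fun x => by
    rw [hnorm, hnorm, hmul, hstar]; exact CStarRing.norm_mul_self_le _⟩
  have i8 : IsScalarTower ℂ (Shrink.{u} C) (Shrink.{u} C) := ⟨fun c x y => e.injective (by
    simp only [smul_eq_mul, hmul, hsmul, smul_mul_assoc])⟩
  have i9 : SMulCommClass ℂ (Shrink.{u} C) (Shrink.{u} C) := ⟨fun c x y => e.injective (by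
    simp only [smul_eq_mul, hmul, hsmul, mul_smul_comm])⟩
  have i10 : StarModule ℂ (Shrink.{u} C) := ⟨fun c x => e.injective (by
    simp only [hstar, hsmul, star_smul])⟩
  exact ⟨Shrink.{u} C, { i3, i5, i6, i7, i4, i8, i9, i10 with }, ⟨{ e with
    map_mul' := hmul, map_add' := hadd, map_smul' := hsmul, map_star' := hstar }⟩⟩

end Small
namespace HilbertBimodule

variable {A : Type u} [NonUnitalCStarAlgebra A] (E : HilbertBimodule A) (K : E.CompactIdeal)

/-- A C⋆-algebra together with a Toeplitz representation of `E` in it that is coisometric on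
`K`. -/
structure CoisometricRep where
  B : Type u
  [cstar : NonUnitalCStarAlgebra B]
  rep : E.ToeplitzRep B
  coisometric : rep.IsCoisometric K

attribute [instance] CoisometricRep.cstar

/-- The direct sum of the maps `ψ`, over all coisometric Toeplitz representations `(ψ, π)`. -/
def sumLin (x : E) : lp (fun i : E.CoisometricRep K => i.B) ∞ :=
  bddElem (fun i => i.rep.toLin x) ‖x‖ fun i => i.rep.norm_toLin_le x

/-- The direct sum of the maps `π`, over all coisometric Toeplitz representations `(ψ, π)`. -/
def sumHom (a : A) : lp (fun i : E.CoisometricRep K => i.B) ∞ :=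
  bddElem (fun i => i.rep.hom a) ‖a‖ fun i => NonUnitalStarAlgHom.norm_apply_le i.rep.hom a

/-- The relative Cuntz–Pimsner algebra `𝒪(E, K)`: the C⋆-algebra generated by the direct sum of all
Toeplitz representations of `E` that are coisometric on `K`. -/
abbrev CuntzPimsner : Type (u + 1) :=
  generated (Set.range (E.sumLin K) ∪ Set.range (E.sumHom K))

/-- The canonical representation of `E` in `𝒪(E, K)`. -/
def cuntzPimsnerRep : E.ToeplitzRep (E.CuntzPimsner K) where
  toLin :=
    { toFun := fun x => ⟨E.sumLin K x, subset_generated _ (Or.inl ⟨x, rfl⟩)⟩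
      map_add' := fun x y => Subtype.ext <| lp.ext <| funext fun i => i.rep.toLin.map_add x y
      map_smul' := fun c x => Subtype.ext <| lp.ext <| funext fun i => i.rep.toLin.map_smul c x }
  hom :=
    { toFun := fun a => ⟨E.sumHom K a, subset_generated _ (Or.inr ⟨a, rfl⟩)⟩
      map_smul' := fun c a => Subtype.ext <| lp.ext <| funext fun i => map_smul i.rep.hom c a
      map_zero' := Subtype.ext <| lp.ext <| funext fun i => map_zero i.rep.hom
      map_add' := fun a b => Subtype.ext <| lp.ext <| funext fun i => map_add i.rep.hom a b
      map_mul' := fun a b => Subtype.ext <| lp.ext <| funext fun i => map_mul i.rep.hom a b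
      map_star' := fun a => Subtype.ext <| lp.ext <| funext fun i => map_star i.rep.hom a }
  map_right x a := Subtype.ext <| lp.ext <| funext fun i => i.rep.map_right x a
  map_inner x y := Subtype.ext <| lp.ext <| funext fun i => i.rep.map_inner x y
  map_left a x := Subtype.ext <| lp.ext <| funext fun i => i.rep.map_left a x

theorem cuntzPimsnerRep_isCoisometric : (E.cuntzPimsnerRep K).IsCoisometric K := by
  intro a ha
  refine Subtype.ext <| lp.ext <| funext fun i => ?_
  have h := (E.cuntzPimsnerRep K).compactMap_map
    ((coordHom i).comp (NonUnitalStarSubalgebraClass.subtype (generated _)))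
    ⟨E.left a, K.left_mem_compacts a ha⟩
  exact h.symm.trans (i.coisometric a ha)

/-- `𝒪(E, K)` is universal for Toeplitz representations that are coisometric on `K`, in
C⋆-algebras of any universe. -/
theorem cuntzPimsner_universal {B : Type w} [NonUnitalCStarAlgebra B] (ψ : E.ToeplitzRep B)
    (hψ : ψ.IsCoisometric K) :
    ∃ f : E.CuntzPimsner K →⋆ₙₐ[ℂ] B, (E.cuntzPimsnerRep K).map f = ψ := by
  let G : E ⊕ A → B := Sum.elim ψ.toLin ψ.hom
  let C := (NonUnitalStarAlgebra.adjoin ℂ (Set.range G)).topologicalClosure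
  have hC : ∀ g, G g ∈ C := fun g =>
    NonUnitalStarSubalgebra.le_topologicalClosure _
      (NonUnitalStarAlgebra.subset_adjoin ℂ _ ⟨g, rfl⟩)
  have : IsClosed (C : Set B) := NonUnitalStarSubalgebra.isClosed_topologicalClosure _
  have : Small.{u} C := small_adjoin_closure G
  obtain ⟨D, _, ⟨e⟩⟩ := exists_small_cstar.{u} C
  let ψC : E.ToeplitzRep C :=
    { toLin := ψ.toLin.codRestrict C.toSubmodule fun x => hC (Sum.inl x)
      hom := NonUnitalStarAlgHom.codRestrict ψ.hom C fun a => hC (Sum.inr a)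
      map_right := fun x a => Subtype.ext (ψ.map_right x a)
      map_inner := fun x y => Subtype.ext (ψ.map_inner x y)
      map_left := fun a x => Subtype.ext (ψ.map_left a x) }
  have hψC : ψC.IsCoisometric K := fun a ha => Subtype.ext <|
    (ψC.compactMap_map (NonUnitalStarSubalgebraClass.subtype C) _).symm.trans (hψ a ha)
  let i : E.CoisometricRep K := ⟨D, ψC.map (e.symm : C →⋆ₙₐ[ℂ] D), fun a ha =>
    (ψC.compactMap_map _ _).trans (congrArg e.symm (hψC a ha))⟩
  refine ⟨((NonUnitalStarSubalgebraClass.subtype C).comp (e : D →⋆ₙₐ[ℂ] C)).comp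
    ((coordHom i).comp (NonUnitalStarSubalgebraClass.subtype (generated _))), ?_⟩
  refine ToeplitzRep.ext (LinearMap.ext fun x => ?_) (NonUnitalStarAlgHom.ext fun a => ?_)
  · exact congrArg Subtype.val (e.apply_symm_apply (ψC.toLin x))
  · exact congrArg Subtype.val (e.apply_symm_apply (ψC.hom a))

end HilbertBimodule

/-! ### Product systems -/

/-- A product system over a commutative monoid `S` of Hilbert bimodules over `A`.  The total
space `Σ s, fibre s` is a semigroup fibred over `S`; the fibre at `0` is `A`, via `unit`.  The
fields `inner_mul` and `dense_mul` say that multiplication extends to an isomorphism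
`X_s ⊗_A X_t ≅ X_{s+t}` for `s, t ≠ 0`. -/
structure ProductSystem (A : Type u) [NonUnitalCStarAlgebra A] (S : Type v) [AddCommMonoid S] where
  fibre : S → HilbertBimodule A
  mul : ∀ {s t : S}, fibre s → fibre t → fibre (s + t)
  mul_assoc : ∀ {s t r : S} (x : fibre s) (y : fibre t) (z : fibre r),
    (⟨s + t + r, mul (mul x y) z⟩ : Σ s, fibre s) = ⟨s + (t + r), mul x (mul y z)⟩
  inner_mul : ∀ {s t : S}, s ≠ 0 → t ≠ 0 → ∀ (x x' : fibre s) (y y' : fibre t),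
    (fibre (s + t)).inner (mul x y) (mul x' y') =
      (fibre t).inner y ((fibre t).left ((fibre s).inner x x') y')
  dense_mul : ∀ {s t : S}, s ≠ 0 → t ≠ 0 →
    Dense (Submodule.span ℂ {z | ∃ (x : fibre s) (y : fibre t), z = mul x y} :
      Set (fibre (s + t)))
  unit : A ≃ₗᵢ[ℂ] fibre 0
  inner_unit : ∀ a b, (fibre 0).inner (unit a) (unit b) = star a * b
  left_unit : ∀ a b, (fibre 0).left a (unit b) = unit (a * b)
  right_unit : ∀ a b, (fibre 0).right (unit a) b = unit (a * b)
  unit_mul : ∀ {s : S} (a : A) (x : fibre s),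
    (⟨0 + s, mul (unit a) x⟩ : Σ s, fibre s) = ⟨s, (fibre s).left a x⟩
  mul_unit : ∀ {s : S} (x : fibre s) (a : A),
    (⟨s + 0, mul x (unit a)⟩ : Σ s, fibre s) = ⟨s, (fibre s).right x a⟩

namespace ProductSystem

variable {A : Type u} [NonUnitalCStarAlgebra A] {S : Type v} [AddCommMonoid S]
  (X : ProductSystem A S)

/-- A Toeplitz representation of a product system in a C⋆-algebra `B`: a multiplicative map on the
total space whose restriction to each fibre, together with its restriction `hom` to
`X_0 = A`, is a Toeplitz representation of that fibre. -/
@[ext]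
structure ToeplitzRep (B : Type w) [NonUnitalCStarAlgebra B] where
  toLin : ∀ s, X.fibre s →ₗ[ℂ] B
  hom : A →⋆ₙₐ[ℂ] B
  toLin_unit : ∀ a, toLin 0 (X.unit a) = hom a
  map_mul : ∀ {s t : S} (x : X.fibre s) (y : X.fibre t),
    toLin (s + t) (X.mul x y) = toLin s x * toLin t y
  map_right : ∀ s x a, toLin s ((X.fibre s).right x a) = toLin s x * hom a
  map_inner : ∀ s x y, star (toLin s x) * toLin s y = hom ((X.fibre s).inner x y)
  map_left : ∀ s a x, toLin s ((X.fibre s).left a x) = hom a * toLin s x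

namespace ToeplitzRep

variable {X} {B : Type w} [NonUnitalCStarAlgebra B] (ψ : X.ToeplitzRep B)

/-- The Toeplitz representation `(ψ_s, ψ_0)` of the fibre at `s`. -/
def fibreRep (s : S) : (X.fibre s).ToeplitzRep B where
  toLin := ψ.toLin s
  hom := ψ.hom
  map_right := ψ.map_right s
  map_inner := ψ.map_inner s
  map_left := ψ.map_left s

/-- `ψ` is coisometric on the family of ideals `K`: each `(ψ_s, ψ_0)` is coisometric on `K_s`. -/
def IsCoisometric (K : ∀ s, (X.fibre s).CompactIdeal) : Prop :=
  ∀ s, (ψ.fibreRep s).IsCoisometric (K s)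

variable {C : Type*} [NonUnitalCStarAlgebra C]

/-- The composition of a Toeplitz representation with a homomorphism. -/
def map (f : B →⋆ₙₐ[ℂ] C) : X.ToeplitzRep C where
  toLin s := (f : B →ₗ[ℂ] C) ∘ₗ ψ.toLin s
  hom := f.comp ψ.hom
  toLin_unit a := by simp [ψ.toLin_unit]
  map_mul x y := by simp [ψ.map_mul]
  map_right s x a := by simp [ψ.map_right]
  map_inner s x y := by simp [← ψ.map_inner, map_star]
  map_left s a x := by simp [ψ.map_left]

end ToeplitzRep

variable (K : ∀ s, (X.fibre s).CompactIdeal)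

/-- A C⋆-algebra together with a Toeplitz representation of `X` in it that is coisometric on
`K`. -/
structure CoisometricRep where
  B : Type (max u v)
  [cstar : NonUnitalCStarAlgebra B]
  rep : X.ToeplitzRep B
  coisometric : rep.IsCoisometric K

attribute [instance] CoisometricRep.cstar

/-- The direct sum of all Toeplitz representations of `X` that are coisometric on `K`. -/
def sumLin (s : S) (x : X.fibre s) : lp (fun i : X.CoisometricRep K => i.B) ∞ :=
  bddElem (fun i => i.rep.toLin s x) ‖x‖ fun i => (i.rep.fibreRep s).norm_toLin_le x

/-- The relative Cuntz–Pimsner algebra `𝒪(X, K)`: the C⋆-algebra generated by the direct sum of all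
Toeplitz representations of `X` that are coisometric on `K`. -/
abbrev CuntzPimsner : Type (max (u + 1) (v + 1)) :=
  generated {z | ∃ s x, z = X.sumLin K s x}

/-- The direct sum of the maps `ψ_0 : A → B`, over all coisometric Toeplitz representations. -/
def sumHom (a : A) : lp (fun i : X.CoisometricRep K => i.B) ∞ :=
  bddElem (fun i => i.rep.hom a) ‖a‖ fun i => NonUnitalStarAlgHom.norm_apply_le i.rep.hom a

theorem sumLin_unit (a : A) : X.sumLin K 0 (X.unit a) = X.sumHom K a :=
  lp.ext <| funext fun i => i.rep.toLin_unit a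

/-- The canonical representation of `X` in `𝒪(X, K)`. -/
def cuntzPimsnerRep : X.ToeplitzRep (X.CuntzPimsner K) where
  toLin s :=
    { toFun := fun x => ⟨X.sumLin K s x, subset_generated _ ⟨s, x, rfl⟩⟩
      map_add' := fun x y => Subtype.ext <| lp.ext <| funext fun i => (i.rep.toLin s).map_add x y
      map_smul' := fun c x => Subtype.ext <| lp.ext <| funext fun i =>
        (i.rep.toLin s).map_smul c x }
  hom :=
    { toFun := fun a =>
        ⟨X.sumHom K a, subset_generated _ ⟨0, X.unit a, (X.sumLin_unit K a).symm⟩⟩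
      map_smul' := fun c a => Subtype.ext <| lp.ext <| funext fun i => map_smul i.rep.hom c a
      map_zero' := Subtype.ext <| lp.ext <| funext fun i => map_zero i.rep.hom
      map_add' := fun a b => Subtype.ext <| lp.ext <| funext fun i => map_add i.rep.hom a b
      map_mul' := fun a b => Subtype.ext <| lp.ext <| funext fun i => _root_.map_mul i.rep.hom a b
      map_star' := fun a => Subtype.ext <| lp.ext <| funext fun i => map_star i.rep.hom a }
  toLin_unit a := Subtype.ext (X.sumLin_unit K a)
  map_mul x y := Subtype.ext <| lp.ext <| funext fun i => i.rep.map_mul x y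
  map_right s x a := Subtype.ext <| lp.ext <| funext fun i => i.rep.map_right s x a
  map_inner s x y := Subtype.ext <| lp.ext <| funext fun i => i.rep.map_inner s x y
  map_left s a x := Subtype.ext <| lp.ext <| funext fun i => i.rep.map_left s a x

theorem cuntzPimsnerRep_isCoisometric : (X.cuntzPimsnerRep K).IsCoisometric K := by
  intro s a ha
  refine Subtype.ext <| lp.ext <| funext fun i => ?_
  have h := ((X.cuntzPimsnerRep K).fibreRep s).compactMap_map
    ((coordHom i).comp (NonUnitalStarSubalgebraClass.subtype (generated _)))
    ⟨(X.fibre s).left a, (K s).left_mem_compacts a ha⟩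
  exact h.symm.trans (i.coisometric s a ha)

/-- `𝒪(X, K)` is universal for Toeplitz representations that are coisometric on `K`, in
C⋆-algebras of any universe. -/
theorem cuntzPimsner_universal {B : Type w} [NonUnitalCStarAlgebra B] (ψ : X.ToeplitzRep B)
    (hψ : ψ.IsCoisometric K) :
    ∃ f : X.CuntzPimsner K →⋆ₙₐ[ℂ] B, (X.cuntzPimsnerRep K).map f = ψ := by
  let G : (Σ s, X.fibre s) → B := fun p => ψ.toLin p.1 p.2
  let C := (NonUnitalStarAlgebra.adjoin ℂ (Set.range G)).topologicalClosure
  have hC : ∀ s x, ψ.toLin s x ∈ C := fun s x =>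
    NonUnitalStarSubalgebra.le_topologicalClosure _
      (NonUnitalStarAlgebra.subset_adjoin ℂ _ ⟨⟨s, x⟩, rfl⟩)
  have : IsClosed (C : Set B) := NonUnitalStarSubalgebra.isClosed_topologicalClosure _
  have : Small.{max u v} C := small_adjoin_closure G
  obtain ⟨D, _, ⟨e⟩⟩ := exists_small_cstar.{max u v} C
  let ψC : X.ToeplitzRep C :=
    { toLin := fun s => (ψ.toLin s).codRestrict C.toSubmodule fun x => hC s x
      hom := NonUnitalStarAlgHom.codRestrict ψ.hom C fun a => by
        rw [← ψ.toLin_unit]; exact hC 0 _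
      toLin_unit := fun a => Subtype.ext (ψ.toLin_unit a)
      map_mul := fun x y => Subtype.ext (ψ.map_mul x y)
      map_right := fun s x a => Subtype.ext (ψ.map_right s x a)
      map_inner := fun s x y => Subtype.ext (ψ.map_inner s x y)
      map_left := fun s a x => Subtype.ext (ψ.map_left s a x) }
  have hψC : ψC.IsCoisometric K := fun s a ha => Subtype.ext <|
    ((ψC.fibreRep s).compactMap_map (NonUnitalStarSubalgebraClass.subtype C) _).symm.trans
      (hψ s a ha)
  let i : X.CoisometricRep K := ⟨D, ψC.map (e.symm : C →⋆ₙₐ[ℂ] D), fun s a ha =>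
    ((ψC.fibreRep s).compactMap_map _ _).trans (congrArg e.symm (hψC s a ha))⟩
  refine ⟨((NonUnitalStarSubalgebraClass.subtype C).comp (e : D →⋆ₙₐ[ℂ] C)).comp
    ((coordHom i).comp (NonUnitalStarSubalgebraClass.subtype (generated _))), ?_⟩
  refine ToeplitzRep.ext (funext fun s => LinearMap.ext fun x => ?_)
    (NonUnitalStarAlgHom.ext fun a => ?_)
  · exact congrArg Subtype.val (e.apply_symm_apply (ψC.toLin s x))
  · exact congrArg Subtype.val (e.apply_symm_apply (ψC.hom a))

end ProductSystem

/-! ### Extendible endomorphisms and the transfer operators -/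

section System

variable {A : Type u} [NonUnitalCStarAlgebra A]

/-- Strict convergence of elements of `A` to a multiplier `m` of `A`.  Here `m.fst a = m a` and
`m.snd a = a m`. -/
def StrictTendsto (f : A → A) (l : Filter A) (m : 𝓜(ℂ, A)) : Prop :=
  ∀ a, Tendsto (fun u => f u * a) l (𝓝 (m.fst a)) ∧ Tendsto (fun u => a * f u) l (𝓝 (m.snd a))

variable [PartialOrder A]

/-- The endomorphism `β` of the multiplier algebra extends `α`, and `β(1)` is the strict limit of
`α(u_λ)` for some approximate unit `(u_λ)` of `A`. -/
def IsExtension (α : A →⋆ₙₐ[ℂ] A) (β : 𝓜(ℂ, A) →⋆ₙₐ[ℂ] 𝓜(ℂ, A)) : Prop :=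
  (∀ a : A, β (a : 𝓜(ℂ, A)) = (α a : 𝓜(ℂ, A))) ∧
    ∃ l : Filter A, l.IsIncreasingApproximateUnit ∧ StrictTendsto α l (β 1)

/-- An action `α` of `S` on `A` by extendible injective endomorphisms with hereditary range. -/
structure IsHereditaryAction {S : Type v} [AddCommMonoid S] (α : S → A →⋆ₙₐ[ℂ] A) : Prop where
  map_zero : α 0 = NonUnitalStarAlgHom.id ℂ A
  map_add : ∀ s t, α (s + t) = (α s).comp (α t)
  extendible : ∀ s, ∃ β, IsExtension (α s) β
  injective : ∀ s, Function.Injective (α s)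
  hereditary : ∀ s a b, 0 ≤ a → a ≤ α s b → a ∈ Set.range (α s)

namespace IsHereditaryAction

variable {S : Type v} [AddCommMonoid S] {α : S → A →⋆ₙₐ[ℂ] A} (h : IsHereditaryAction α)

/-- The extension of `α_s` to the multiplier algebra. -/
def ext (s : S) : 𝓜(ℂ, A) →⋆ₙₐ[ℂ] 𝓜(ℂ, A) := (h.extendible s).choose

/-- The projection `p_s`, the image of `1` under the extension of `α_s`. -/
def proj (s : S) : 𝓜(ℂ, A) := h.ext s 1

theorem continuous_map (h : IsHereditaryAction α) (s : S) : Continuous (α s) :=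
  (NonUnitalStarAlgHom.isometry (α s) (h.injective s)).continuous

theorem ext_coe (s : S) (a : A) : h.ext s (a : 𝓜(ℂ, A)) = (α s a : 𝓜(ℂ, A)) :=
  (h.extendible s).choose_spec.1 a

theorem exists_approx (s : S) :
    ∃ l : Filter A, l.IsIncreasingApproximateUnit ∧ StrictTendsto (α s) l (h.proj s) :=
  (h.extendible s).choose_spec.2

theorem map_add_apply (h : IsHereditaryAction α) (s t : S) (a : A) : α (s + t) a = α s (α t a) := by
  rw [h.map_add]; rfl

theorem proj_mul_proj (s : S) : h.proj s * h.proj s = h.proj s := by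
  rw [proj, ← map_mul, mul_one]

theorem star_proj (s : S) : star (h.proj s) = h.proj s := by
  rw [proj, ← map_star, star_one]

theorem snd_snd (s : S) (a : A) : (h.proj s).snd ((h.proj s).snd a) = (h.proj s).snd a := by
  conv_rhs => rw [← h.proj_mul_proj s, DoubleCentralizer.mul_snd]
  rfl

theorem star_snd (s : S) (a : A) : star ((h.proj s).snd a) = (h.proj s).fst (star a) := by
  conv_rhs => rw [← h.star_proj s, DoubleCentralizer.star_fst, star_star]

theorem star_fst (s : S) (a : A) : star ((h.proj s).fst a) = (h.proj s).snd (star a) := by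
  conv_rhs => rw [← h.star_proj s, DoubleCentralizer.star_snd, star_star]

theorem fst_map (s : S) (a : A) : (h.proj s).fst (α s a) = α s a := by
  obtain ⟨l, hl, hs⟩ := h.exists_approx s
  have := hl.neBot
  refine tendsto_nhds_unique (hs (α s a)).1 ?_
  have := ((h.continuous_map s).tendsto a).comp (hl.tendsto_mul_right a)
  simpa [Function.comp_def] using this

theorem snd_map (s : S) (a : A) : (h.proj s).snd (α s a) = α s a := by
  rw [← star_star (α s a), ← h.star_fst, ← map_star (α s), h.fst_map]

theorem fst_mul (s : S) (a b : A) : (h.proj s).fst (a * b) = (h.proj s).fst a * b := by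
  obtain ⟨l, hl, hs⟩ := h.exists_approx s
  have := hl.neBot
  refine tendsto_nhds_unique (hs (a * b)).1 ?_
  simpa [mul_assoc] using (hs a).1.mul_const b

theorem snd_mul (s : S) (a b : A) : (h.proj s).snd (a * b) = a * (h.proj s).snd b := by
  obtain ⟨l, hl, hs⟩ := h.exists_approx s
  have := hl.neBot
  refine tendsto_nhds_unique (hs (a * b)).2 ?_
  simpa [mul_assoc] using (hs b).2.const_mul a

theorem isClosed_range (h : IsHereditaryAction α) (s : S) : IsClosed (Set.range (α s)) :=
  (NonUnitalStarAlgHom.isometry (α s) (h.injective s)).isClosedEmbedding.isClosed_range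

theorem exists_transfer [StarOrderedRing A] (s : S) (a : A) :
    ∃ c, α s c = (h.proj s).fst ((h.proj s).snd a) := by
  obtain ⟨l, hl, hs⟩ := h.exists_approx s
  have := hl.neBot
  -- `α(v) a α(v)` belongs to the range, for self-adjoint `v`
  have h1 : ∀ v, IsSelfAdjoint v → ∀ a, α s v * a * α s v ∈ LinearMap.range (α s : A →ₗ[ℂ] A) := by
    intro v hv a
    have ha : a ∈ Submodule.span ℂ {a : A | 0 ≤ a} := by
      rw [CStarAlgebra.span_nonneg]; trivial
    induction ha using Submodule.span_induction with
    | mem a ha =>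
      have hv' : star (α s v) = α s v := by rw [← map_star, hv.star_eq]
      have h2 : 0 ≤ star (α s v) * a * α s v := star_left_conjugate_nonneg ha _
      have h3 : star (α s v) * a * α s v ≤ ‖a‖ • (star (α s v) * α s v) :=
        CStarAlgebra.star_left_conjugate_le_norm_smul (IsSelfAdjoint.of_nonneg ha)
      rw [hv'] at h2 h3
      have h4 : ‖a‖ • (α s v * α s v) = α s ((‖a‖ : ℂ) • (v * v)) := by
        rw [map_smul, map_mul]; rfl
      rw [h4] at h3
      exact h.hereditary s _ _ h2 h3
    | zero => simp
    | add a b _ _ ha hb => rw [mul_add, add_mul]; exact add_mem ha hb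
    | smul c a _ ha =>
      rw [mul_smul_comm, smul_mul_assoc]; exact Submodule.smul_mem _ _ ha
  have h2 : Tendsto (fun u => α s u * a * α s u) l (𝓝 ((h.proj s).fst ((h.proj s).snd a))) := by
    have h3 : Tendsto (fun u => α s u * (a * α s u - (h.proj s).snd a)) l (𝓝 0) := by
      refine isBoundedUnder_le_mul_tendsto_zero ⟨1, ?_⟩ ?_
      · rw [eventually_map]
        filter_upwards [hl.eventually_norm] with u hu
        exact (NonUnitalStarAlgHom.norm_apply_le (α s) u).trans hu
      · exact tendsto_sub_nhds_zero_iff.2 (hs a).2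
    have h4 := h3.add (hs ((h.proj s).snd a)).1
    rw [zero_add] at h4
    refine h4.congr fun u => ?_
    rw [mul_sub, sub_add_cancel, mul_assoc]
  refine (h.isClosed_range s).mem_of_tendsto h2 ?_
  filter_upwards [hl.eventually_isSelfAdjoint] with u hu
  exact h1 u hu a

/-- The module `A_s = A p_s`. -/
def fibreModule (s : S) : Submodule ℂ A := LinearMap.range ((h.proj s).snd : A →ₗ[ℂ] A)

theorem mem_fibreModule (s : S) (x : A) : x ∈ h.fibreModule s ↔ (h.proj s).snd x = x := by
  constructor
  · rintro ⟨a, rfl⟩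
    exact h.snd_snd s a
  · exact fun hx => ⟨x, hx⟩

theorem snd_coe {s : S} (x : h.fibreModule s) : (h.proj s).snd (x : A) = x :=
  (h.mem_fibreModule s x).1 x.2

theorem fst_star_coe {s : S} (x : h.fibreModule s) : (h.proj s).fst (star (x : A)) = star (x : A) := by
  rw [← h.star_snd, h.snd_coe]

theorem mul_mem_fibreModule {s : S} (a : A) {x : A} (hx : x ∈ h.fibreModule s) :
    a * x ∈ h.fibreModule s := by
  rw [mem_fibreModule] at hx ⊢
  rw [h.snd_mul, hx]

theorem map_mem_fibreModule (s : S) (a : A) : α s a ∈ h.fibreModule s :=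
  (h.mem_fibreModule s _).2 (h.snd_map s a)

theorem isClosed_fibreModule (s : S) : IsClosed (h.fibreModule s : Set A) := by
  have : (h.fibreModule s : Set A) = {x | (h.proj s).snd x = x} :=
    Set.ext fun x => h.mem_fibreModule s x
  rw [this]
  exact isClosed_eq (h.proj s).snd.continuous continuous_id

variable [StarOrderedRing A]

/-- The transfer operator `L_s(a) = α_s⁻¹(p_s a p_s)`. -/
def transfer (s : S) (a : A) : A := (h.exists_transfer s a).choose

theorem map_transfer (s : S) (a : A) :
    α s (h.transfer s a) = (h.proj s).fst ((h.proj s).snd a) :=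
  (h.exists_transfer s a).choose_spec

/-! ### The product system of the action -/

theorem map_transfer_inner {s : S} (x y : h.fibreModule s) :
    α s (h.transfer s (star (x : A) * y)) = star (x : A) * y := by
  rw [h.map_transfer, h.snd_mul, h.snd_coe, h.fst_mul, h.fst_star_coe]

theorem transfer_inner_nonneg {s : S} (x : h.fibreModule s) :
    ∃ b, h.transfer s (star (x : A) * x) = star b * b := by
  let y : A := CFC.sqrt (star (x : A) * x)
  have hy0 : 0 ≤ star (x : A) * (x : A) := star_mul_self_nonneg _
  have hy : y * y = star (x : A) * x := CFC.sqrt_mul_sqrt_self _ hy0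
  have hysa : star y = y := (IsSelfAdjoint.of_nonneg (CFC.sqrt_nonneg _)).star_eq
  have h1 : (h.proj s).snd y = y := by
    rw [← sub_eq_zero, ← norm_eq_zero, ← mul_self_eq_zero, ← CStarRing.norm_star_mul_self]
    have h2 : star ((h.proj s).snd y - y) * ((h.proj s).snd y - y) = 0 := by
      have e1 : (h.proj s).snd (y * y) = y * y := by rw [hy, h.snd_mul, h.snd_coe]
      have e2 : (h.proj s).fst (y * y) = y * y := by rw [hy, h.fst_mul, h.fst_star_coe]
      rw [star_sub, h.star_snd, hysa, sub_mul, mul_sub, mul_sub, ← h.snd_mul, ← h.snd_mul,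
        ← h.fst_mul, e2, e1, sub_self]
    rw [h2, norm_zero]
  have h3 : (h.proj s).fst y = y := by
    conv_lhs => rw [← hysa, ← h.star_snd, h1, hysa]
  obtain ⟨d, hd⟩ := h.exists_transfer s y
  rw [h1, h3] at hd
  refine ⟨d, h.injective s ?_⟩
  rw [h.map_transfer_inner, map_mul, map_star, hd, hysa, hy]

/-- The Hilbert bimodule `X_s`: the space `A_s = A p_s` with `x · a = x α_s(a)`,
`⟨x, y⟩ = L_s(x⋆ y)` and `φ_s(a) x = a x`.  Since `α_s` is isometric and `x⋆ x ∈ α_s(A)`, the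
norm `‖L_s(x⋆ x)‖^{1/2}` is the norm of `A`; thus the inner product is definite and `A_s`, which is
closed in `A`, is already complete (see the fields `completeSpace` and `norm_sq`). -/
def fibre (s : S) : HilbertBimodule A where
  carrier := h.fibreModule s
  completeSpace := (h.isClosed_fibreModule s).completeSpace_coe
  right := LinearMap.mk₂ ℂ
    (fun x a => ⟨x * α s a, h.mul_mem_fibreModule _ (h.map_mem_fibreModule s a)⟩)
    (fun x y a => Subtype.ext (add_mul _ _ _))
    (fun c x a => Subtype.ext (smul_mul_assoc _ _ _))
    (fun x a b => Subtype.ext (by simp [mul_add]))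
    (fun c x a => Subtype.ext (by simp [mul_smul_comm]))
  right_mul x a b := Subtype.ext (by simp [mul_assoc])
  inner x y := h.transfer s (star (x : A) * y)
  inner_add_right x y z := h.injective s (by
    rw [_root_.map_add, h.map_transfer_inner, h.map_transfer_inner, h.map_transfer_inner,
      Submodule.coe_add, mul_add])
  inner_smul_right c x y := h.injective s (by
    rw [map_smul, h.map_transfer_inner, h.map_transfer_inner, Submodule.coe_smul, mul_smul_comm])
  inner_right x y a := h.injective s (by
    rw [map_mul, h.map_transfer_inner, h.map_transfer_inner]
    simp [mul_assoc])
  star_inner x y := h.injective s (by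
    rw [map_star, h.map_transfer_inner, h.map_transfer_inner, star_mul, star_star])
  inner_self_nonneg x := h.transfer_inner_nonneg x
  norm_sq x := by
    rw [← NonUnitalStarAlgHom.norm_map (α s) (h.injective s), h.map_transfer_inner,
      CStarRing.norm_star_mul_self, sq]
    rfl
  left :=
    { toFun := fun a => LinearMap.mkContinuous
        { toFun := fun x => ⟨a * x, h.mul_mem_fibreModule a x.2⟩
          map_add' := fun x y => Subtype.ext (mul_add _ _ _)
          map_smul' := fun c x => Subtype.ext (mul_smul_comm _ _ _) }
        ‖a‖ fun x => norm_mul_le a (x : A)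
      map_smul' := fun c a => by ext x; exact smul_mul_assoc c a (x : A)
      map_zero' := by ext x; exact zero_mul (x : A)
      map_add' := fun a b => by ext x; exact add_mul a b (x : A)
      map_mul' := fun a b => by ext x; exact mul_assoc a b (x : A) }
  inner_left a x y := by
    change h.transfer s (star (a * (x : A)) * y) = h.transfer s (star (x : A) * (star a * y))
    rw [star_mul, mul_assoc]

theorem mul_map_mem {s t : S} (x : h.fibreModule s) (y : h.fibreModule t) :
    (x : A) * α s y ∈ h.fibreModule (s + t) := by
  refine h.mul_mem_fibreModule _ ?_
  obtain ⟨l, hl, hs⟩ := h.exists_approx t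
  have := hl.neBot
  have h1 := ((h.continuous_map s).tendsto _).comp (hs y).2
  rw [h.snd_coe] at h1
  refine (h.isClosed_fibreModule (s + t)).mem_of_tendsto h1 (.of_forall fun u => ?_)
  simp only [Function.comp_apply, map_mul]
  rw [← h.map_add_apply]
  exact h.mul_mem_fibreModule _ (h.map_mem_fibreModule _ _)

theorem fibre_ext {s t : S} (hst : s = t) (x : h.fibre s) (y : h.fibre t)
    (hxy : (x : h.fibreModule s).1 = (y : h.fibreModule t).1) :
    (⟨s, x⟩ : Σ s, h.fibre s) = ⟨t, y⟩ := by
  subst hst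
  exact congrArg _ (Subtype.ext hxy)

theorem proj_zero_snd (a : A) : a ∈ h.fibreModule 0 := by
  have := h.map_mem_fibreModule 0 a
  rw [h.map_zero] at this
  exact this

theorem transfer_zero (a b : A) : h.transfer 0 (star a * b) = star a * b := by
  have := h.map_transfer_inner (s := 0) ⟨a, h.proj_zero_snd a⟩ ⟨b, h.proj_zero_snd b⟩
  rw [h.map_zero] at this
  exact this

/-- The product system of the action, with multiplication
`(a p_s) (b p_t) = a α_s(b p_t)`, that is, `x y = x α_s(y)` for `x ∈ X_s` and `y ∈ X_t`. -/
def productSystem : ProductSystem A S where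
  fibre := h.fibre
  mul {s t} x y := ⟨(x : h.fibreModule s).1 * α s (y : h.fibreModule t).1, h.mul_map_mem x y⟩
  mul_assoc {s t r} x y z := h.fibre_ext (add_assoc s t r) _ _ (by
    change (x : h.fibreModule s).1 * α s (y : h.fibreModule t).1 *
      α (s + t) (z : h.fibreModule r).1 = (x : h.fibreModule s).1 *
        α s ((y : h.fibreModule t).1 * α t (z : h.fibreModule r).1)
    rw [map_mul, h.map_add_apply, mul_assoc])
  inner_mul {s t} _ _ x x' y y' := h.injective (s + t) (by
    have h1 := h.map_transfer_inner (s := s + t) ⟨_, h.mul_map_mem x y⟩ ⟨_, h.mul_map_mem x' y'⟩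
    refine h1.trans ?_
    have h2 := h.map_transfer_inner (s := t) y
      ⟨_, h.mul_mem_fibreModule (h.transfer s (star (x : h.fibreModule s).1 *
        (x' : h.fibreModule s).1)) (y' : h.fibreModule t).2⟩
    have h3 := (h.map_add_apply s t _).trans (congrArg (α s) h2)
    refine Eq.trans ?_ h3.symm
    simp only [map_mul, map_star]
    rw [h.map_transfer_inner (s := s) x x', star_mul]
    simp only [mul_assoc])
  dense_mul {s t} _ _ := by
    intro z
    obtain ⟨l, hl, hs⟩ := h.exists_approx (s + t)
    have := hl.neBot
    have h1 := (hs (z : h.fibreModule (s + t)).1).2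
    rw [show (h.proj (s + t)).snd (z : h.fibreModule (s + t)).1 = _ from
      h.snd_coe (s := s + t) z] at h1
    let f : A → h.fibre (s + t) := fun u =>
      ⟨(z : h.fibreModule (s + t)).1 * α (s + t) u,
        h.mul_mem_fibreModule _ (h.map_mem_fibreModule _ _)⟩
    have h2 : Tendsto f l (𝓝 z) := tendsto_subtype_rng.2 h1
    refine mem_closure_of_tendsto h2 (.of_forall fun u => Submodule.subset_span ?_)
    refine ⟨⟨(h.proj s).snd (z : h.fibreModule (s + t)).1, _, rfl⟩,
      ⟨α t u, h.map_mem_fibreModule t u⟩, Subtype.ext ?_⟩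
    change (z : h.fibreModule (s + t)).1 * α (s + t) u =
      (h.proj s).snd (z : h.fibreModule (s + t)).1 * α s (α t u)
    rw [(h.proj s).central, h.fst_map, h.map_add_apply]
  unit :=
    { toFun := fun a => ⟨a, h.proj_zero_snd a⟩
      invFun := fun x => (x : h.fibreModule 0).1
      map_add' := fun _ _ => rfl
      map_smul' := fun _ _ => rfl
      left_inv := fun _ => rfl
      right_inv := fun _ => rfl
      norm_map' := fun _ => rfl }
  inner_unit a b := h.transfer_zero a b
  left_unit a b := rfl
  right_unit a b := Subtype.ext (by
    change a * α 0 b = a * b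
    rw [h.map_zero]; rfl)
  unit_mul {s} a x := h.fibre_ext (zero_add s) _ _ (by
    change a * α 0 (x : h.fibreModule s).1 = a * (x : h.fibreModule s).1
    rw [h.map_zero]; rfl)
  mul_unit {s} x a := h.fibre_ext (add_zero s) _ _ rfl

/-- The ideal `K_s`, the closed linear span of `A α_s(A) A`. -/
def ideal (s : S) : (h.productSystem.fibre s).CompactIdeal where
  carrier := (Submodule.span ℂ {x | ∃ a b c, x = a * α s b * c}).topologicalClosure
  isClosed := Submodule.isClosed_topologicalClosure _
  mul_mem_left a b hb := by
    refine map_mem_closure (f := (a * ·)) (by fun_prop) hb fun x hx => ?_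
    induction hx using Submodule.span_induction with
    | mem x hx =>
      obtain ⟨c, d, e, rfl⟩ := hx
      exact Submodule.subset_span ⟨a * c, d, e, by simp [mul_assoc]⟩
    | zero => simp
    | add x y _ _ hx hy => simpa [mul_add] using add_mem hx hy
    | smul c x _ hx => simpa [mul_smul_comm] using Submodule.smul_mem _ c hx
  mul_mem_right a b hb := by
    refine map_mem_closure (f := (· * a)) (by fun_prop) hb fun x hx => ?_
    induction hx using Submodule.span_induction with
    | mem x hx =>
      obtain ⟨c, d, e, rfl⟩ := hx
      exact Submodule.subset_span ⟨c, d, e * a, by simp [mul_assoc]⟩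
    | zero => simp
    | add x y _ _ hx hy => simpa [add_mul] using add_mem hx hy
    | smul c x _ hx => simpa [smul_mul_assoc] using Submodule.smul_mem _ c hx
  left_mem_compacts a ha := by
    have hc : Continuous (h.fibre s).left :=
      AddMonoidHomClass.continuous_of_bound (h.fibre s).left 1 fun a => by
        rw [one_mul]
        exact ContinuousLinearMap.opNorm_le_bound _ (norm_nonneg _) fun x =>
          norm_mul_le a (x : h.fibreModule s).1
    refine closure_minimal (t := (h.fibre s).left ⁻¹' ((h.fibre s).compacts)) ?_
      ((Submodule.isClosed_topologicalClosure _).preimage hc) ha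
    intro x hx
    change (h.fibre s).left x ∈ (h.fibre s).compacts
    induction hx using Submodule.span_induction with
    | mem x hx =>
      obtain ⟨a, b, c, rfl⟩ := hx
      let u : h.fibre s := ⟨a * α s b, h.mul_mem_fibreModule _ (h.map_mem_fibreModule _ _)⟩
      let v : h.fibre s := ⟨(h.proj s).snd (star c), star c, rfl⟩
      have : (h.fibre s).left (a * α s b * c) = (h.fibre s).theta u v := by
        refine ContinuousLinearMap.ext fun z => Subtype.ext ?_
        change a * α s b * c * (z : h.fibreModule s).1 =
          a * α s b * α s (h.transfer s (star ((h.proj s).snd (star c)) *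
            (z : h.fibreModule s).1))
        rw [h.map_transfer_inner (s := s) v z]
        change _ = a * α s b * (star ((h.proj s).snd (star c)) * (z : h.fibreModule s).1)
        rw [h.star_snd, star_star, ← mul_assoc, mul_assoc a (α s b) ((h.proj s).fst c),
          ← (h.proj s).central, h.snd_map, ← mul_assoc]
      rw [this]
      exact (h.fibre s).theta_mem_compacts u v
    | zero => rw [_root_.map_zero]; exact zero_mem _
    | add x y _ _ hx hy => rw [_root_.map_add]; exact add_mem hx hy
    | smul c x _ hx => rw [map_smul]; exact Submodule.smul_mem _ c hx

end IsHereditaryAction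

end System

end RelCP

end

noncomputable section

namespace RelCP

open scoped MultiplierAlgebra ENNReal Topology
open Filter

/-! ### Strict limits in multiplier algebras -/

section Multiplier

variable {B : Type w} [NonUnitalCStarAlgebra B]

/-! Let `B` be `𝒪(X_1, K_1)`, with universal representation `(k, π)`. As `u` runs through an
approximate unit of `A` with `α_1(u) → p_1` strictly, the elements `k(α_1(u))` converge strictly to
a multiplier `m` of `B`, which implements `α_1`: `k(x) = π(x) m` for `x ∈ A p_1`, `m π(a) =
π(α_1(a)) m`, and `m⋆ π(α_1(a)) m = π(a)`. These three relations use only the Toeplitz identities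
and the nondegeneracy of `π` in `B`. Coisometry on `K_1` adds a fourth, `m π(a) m⋆ = π(α_1(a))`: it
is the coisometry identity on the generators `a α_1(b) c` of `K_1`, with the outer factors cancelled
by nondegeneracy. This is `IsNondegenerateAlong.exists_implements`.

Because `α_n` is the `n`-th iterate of `α_1`, the relations pass to `m ^ n` and `α_n`. Hence `x ↦
π(x) m ^ n` on `X_n` defines a Toeplitz representation of the whole product system that restricts to
`(k, π)` on `X_1` (`Implements.powRep`). The fourth relation for `m ^ n` makes it coisometric on
every `K_n` (`Implements.powRep_isCoisometric`), so coisometry at `1` already forces coisometry at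
all `n`.

The two universal properties now give homomorphisms in both directions. They are mutually inverse
because a representation of the product system is determined by its values on `X_1` and `A`: the
products `X_n X_1` span a dense subspace of `X_{n+1}` (`ext_of_fibreRep_one`,
`exists_starAlgEquiv_of_fibreRep_one`). -/

/-- The inclusion of `B` in its multiplier algebra. -/
def multiplierHom (B : Type w) [NonUnitalCStarAlgebra B] : B →⋆ₙₐ[ℂ] 𝓜(ℂ, B) :=
  DoubleCentralizer.coeHom

theorem multiplierHom_mul (b : B) (m : 𝓜(ℂ, B)) :
    multiplierHom B b * m = multiplierHom B (m.snd b) := by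
  -- Centrality alone gives linearity: `m.snd (x * y) - x * m.snd y` annihilates every element on
  -- its right, in particular its own adjoint, so it vanishes by the C⋆-identity.
  have hmul : ∀ x y, m.snd (x * y) = x * m.snd y := fun x y => by
    refine sub_eq_zero.1 ((CStarRing.mul_star_self_eq_zero_iff _).1 ?_)
    rw [sub_mul, m.central, mul_assoc, mul_assoc x (m.snd y), m.central, sub_self]
  refine DoubleCentralizer.ext ℂ B _ _ (Prod.ext ?_ ?_)
  · ext x
    exact (m.central b x).symm
  · ext x
    exact hmul x b

theorem mul_multiplierHom (m : 𝓜(ℂ, B)) (b : B) :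
    m * multiplierHom B b = multiplierHom B (m.fst b) := by
  have hmul : ∀ x y, m.fst (x * y) = m.fst x * y := fun x y => by
    refine sub_eq_zero.1 ((CStarRing.star_mul_self_eq_zero_iff _).1 ?_)
    rw [mul_sub, ← m.central, ← mul_assoc, ← mul_assoc _ (m.fst x), ← m.central, sub_self]
  refine DoubleCentralizer.ext ℂ B _ _ (Prod.ext ?_ ?_)
  · ext x
    exact hmul b x
  · ext x
    exact m.central x b

/-- An element killing `B` by left multiplication kills its own adjoint, hence is zero. Through this
lemma, identities computed in the multiplier algebra, where `m` lives, descend to `B`. -/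
theorem multiplierHom_injective : Function.Injective (multiplierHom B) := by
  intro b c hbc
  have h1 : ∀ x, b * x = c * x := fun x =>
    congrArg (fun m : 𝓜(ℂ, B) => m.fst x) hbc
  refine sub_eq_zero.1 ((CStarRing.mul_star_self_eq_zero_iff _).1 ?_)
  rw [sub_mul, h1, sub_self]

variable {ι : Type v} {l : Filter ι} [l.NeBot]

/-- Convergence of a net of maps that are eventually contractive need only be checked on a
dense set. -/
theorem isClosed_exists_tendsto {V : Type w} [NormedAddCommGroup V] [CompleteSpace V]
    (F : ι → V → V) (hF : ∀ᶠ i in l, ∀ b c, ‖F i b - F i c‖ ≤ ‖b - c‖) :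
    IsClosed {b | ∃ c, Tendsto (fun i => F i b) l (𝓝 c)} := by
  refine isClosed_of_closure_subset fun b hb => ?_
  refine cauchy_map_iff_exists_tendsto.1 (Metric.cauchy_iff.2 ⟨inferInstance, fun ε hε => ?_⟩)
  -- The limit `c` found for a nearby `b'` eventually lies within `ε / 2` of `F i b`, so the net at
  -- `b` is Cauchy.
  obtain ⟨b', ⟨c, hc⟩, hbb⟩ := Metric.mem_closure_iff.1 hb (ε / 4) (by positivity)
  have h1 : ∀ᶠ i in l, ‖F i b - c‖ < ε / 2 := by
    filter_upwards [hF, Metric.tendsto_nhds.1 hc (ε / 4) (by positivity)] with i h2 h3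
    rw [dist_eq_norm] at h3 hbb
    calc ‖F i b - c‖ = ‖(F i b - F i b') + (F i b' - c)‖ := by congr 1; abel
      _ ≤ ‖F i b - F i b'‖ + ‖F i b' - c‖ := norm_add_le _ _
      _ < ε / 2 := by linarith [h2 b b']
  refine ⟨_, image_mem_map h1, ?_⟩
  rintro _ ⟨i, hi, rfl⟩ _ ⟨j, hj, rfl⟩
  calc dist (F i b) (F j b) ≤ dist (F i b) c + dist (F j b) c := dist_triangle_right _ _ _
    _ < ε := by rw [dist_eq_norm, dist_eq_norm]; linarith [hi.out, hj.out]

/-- A net of contractions that converges strictly converges to a multiplier. -/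
theorem exists_multiplier_of_tendsto (f : ι → B) (hf : ∀ᶠ i in l, ‖f i‖ ≤ 1)
    (hleft : ∀ b, ∃ c, Tendsto (fun i => f i * b) l (𝓝 c))
    (hright : ∀ b, ∃ c, Tendsto (fun i => b * f i) l (𝓝 c)) :
    ∃ m : 𝓜(ℂ, B), ∀ b, Tendsto (fun i => f i * b) l (𝓝 (m.fst b)) ∧
      Tendsto (fun i => b * f i) l (𝓝 (m.snd b)) := by
  choose L hL using hleft
  choose R hR using hright
  let L' : B →L[ℂ] B := LinearMap.mkContinuous
    { toFun := L
      map_add' := fun x y => tendsto_nhds_unique (hL (x + y))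
        (by simpa only [mul_add] using (hL x).add (hL y))
      map_smul' := fun c x => tendsto_nhds_unique (hL (c • x))
        (by simpa only [mul_smul_comm, RingHom.id_apply] using (hL x).const_smul c) } 1 fun x => by
    refine le_of_tendsto (hL x).norm (hf.mono fun i hi => (norm_mul_le _ _).trans ?_)
    gcongr
  let R' : B →L[ℂ] B := LinearMap.mkContinuous
    { toFun := R
      map_add' := fun x y => tendsto_nhds_unique (hR (x + y))
        (by simpa only [add_mul] using (hR x).add (hR y))
      map_smul' := fun c x => tendsto_nhds_unique (hR (c • x))
        (by simpa only [smul_mul_assoc, RingHom.id_apply] using (hR x).const_smul c) } 1 fun x => by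
    refine le_of_tendsto (hR x).norm (hf.mono fun i hi => (norm_mul_le _ _).trans ?_)
    rw [mul_comm]
    gcongr
  -- Centrality of the pair is the limit of `(x * f i) * y = x * (f i * y)`.
  exact ⟨⟨(L', R'), fun x y => tendsto_nhds_unique ((hR x).mul_const y)
    (((hL y).const_mul x).congr fun _ => (mul_assoc _ _ _).symm)⟩, fun b => ⟨hL b, hR b⟩⟩

end Multiplier

/-! ### Homomorphisms on relative Cuntz–Pimsner algebras are determined on generators -/

theorem continuous_nonUnitalStarAlgHom {B : Type v} {C : Type w} [NonUnitalCStarAlgebra B]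
    [NonUnitalCStarAlgebra C] (f : B →⋆ₙₐ[ℂ] C) : Continuous f :=
  AddMonoidHomClass.continuous_of_bound f 1 fun x => by
    simpa using NonUnitalStarAlgHom.norm_apply_le f x

/-- A closed set of elements of the C⋆-algebra generated by `G` that contains `G` and is closed
under the operations is everything. -/
theorem mem_of_generators_mem {ι : Type v} {B : ι → Type w} [∀ i, NonUnitalCStarAlgebra (B i)]
    {G : Set (lp B ∞)} (M : NonUnitalStarSubalgebra ℂ (generated G))
    (hM : IsClosed (M : Set (generated G))) (hG : ∀ g (hg : g ∈ G), ⟨g, subset_generated G hg⟩ ∈ M)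
    (x : generated G) : x ∈ M := by
  have hle : NonUnitalStarAlgebra.adjoin ℂ G ≤
      M.map (NonUnitalStarSubalgebraClass.subtype (generated G)) :=
    NonUnitalStarAlgebra.adjoin_le fun g hg => ⟨⟨g, subset_generated G hg⟩, hG g hg, rfl⟩
  -- The generated algebra is closed in the product, so `M` stays closed there and absorbs the
  -- closure of the `⋆`-algebra generated by `G`.
  have hclosed : IsClosed (Subtype.val '' (M : Set (generated G)) : Set (lp B ∞)) :=
    (NonUnitalStarSubalgebra.isClosed_topologicalClosure _).isClosedEmbedding_subtypeVal.isClosedMap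
      _ hM
  obtain ⟨y, hy, hyx⟩ := closure_minimal (fun z hz => hle hz) hclosed x.2
  rwa [← Subtype.ext hyx]

namespace HilbertBimodule

variable {A : Type u} [NonUnitalCStarAlgebra A] (E : HilbertBimodule A) (K : E.CompactIdeal)

theorem cuntzPimsner_mem (M : NonUnitalStarSubalgebra ℂ (E.CuntzPimsner K))
    (hM : IsClosed (M : Set (E.CuntzPimsner K))) (hlin : ∀ x, (E.cuntzPimsnerRep K).toLin x ∈ M)
    (hhom : ∀ a, (E.cuntzPimsnerRep K).hom a ∈ M) (z : E.CuntzPimsner K) : z ∈ M := by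
  refine mem_of_generators_mem M hM ?_ z
  rintro _ (⟨x, rfl⟩ | ⟨a, rfl⟩)
  · exact hlin x
  · exact hhom a

theorem cuntzPimsner_hom_ext {B : Type w} [NonUnitalCStarAlgebra B]
    {f g : E.CuntzPimsner K →⋆ₙₐ[ℂ] B}
    (hfg : (E.cuntzPimsnerRep K).map f = (E.cuntzPimsnerRep K).map g) : f = g := by
  refine NonUnitalStarAlgHom.ext fun z => E.cuntzPimsner_mem K (NonUnitalStarAlgHom.equalizer f g)
    (isClosed_eq (continuous_nonUnitalStarAlgHom f) (continuous_nonUnitalStarAlgHom g)) ?_ ?_ z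
  · exact fun x => congrArg (fun ψ : E.ToeplitzRep B => ψ.toLin x) hfg
  · exact fun a => congrArg (fun ψ : E.ToeplitzRep B => ψ.hom a) hfg

end HilbertBimodule

namespace ProductSystem

variable {A : Type u} [NonUnitalCStarAlgebra A]

theorem cuntzPimsner_hom_ext {S : Type v} [AddCommMonoid S] (X : ProductSystem A S)
    (K : ∀ s, (X.fibre s).CompactIdeal) {B : Type w} [NonUnitalCStarAlgebra B]
    {f g : X.CuntzPimsner K →⋆ₙₐ[ℂ] B}
    (hfg : (X.cuntzPimsnerRep K).map f = (X.cuntzPimsnerRep K).map g) : f = g := by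
  refine NonUnitalStarAlgHom.ext fun z => mem_of_generators_mem (NonUnitalStarAlgHom.equalizer f g)
    (isClosed_eq (continuous_nonUnitalStarAlgHom f) (continuous_nonUnitalStarAlgHom g)) ?_ z
  rintro _ ⟨s, x, rfl⟩
  exact congrArg (fun ψ : X.ToeplitzRep B => ψ.toLin s x) hfg

/-! ### Representations over `ℕ` and their restriction to the fibre at `1` -/

namespace ToeplitzRep

theorem continuous_toLin {S : Type v} [AddCommMonoid S] {X : ProductSystem A S} {B : Type w}
    [NonUnitalCStarAlgebra B] (ψ : X.ToeplitzRep B) (s : S) : Continuous (ψ.toLin s) :=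
  AddMonoidHomClass.continuous_of_bound (ψ.toLin s) 1 fun x => by
    rw [one_mul]
    exact (ψ.fibreRep s).norm_toLin_le x

/-- A Toeplitz representation of a product system over `ℕ` is determined by its restriction to the
fibre at `1`. -/
theorem ext_of_fibreRep_one {X : ProductSystem A ℕ} {B : Type w} [NonUnitalCStarAlgebra B]
    {ψ χ : X.ToeplitzRep B} (hψχ : ψ.fibreRep 1 = χ.fibreRep 1) : ψ = χ := by
  have hone : ∀ x, ψ.toLin 1 x = χ.toLin 1 x := fun x =>
    congrArg (fun ρ : (X.fibre 1).ToeplitzRep B => ρ.toLin x) hψχ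
  have hhom : ψ.hom = χ.hom :=
    congrArg (fun ρ : (X.fibre 1).ToeplitzRep B => ρ.hom) hψχ
  refine ToeplitzRep.ext (funext fun n => LinearMap.ext fun x => ?_) hhom
  induction n with
  | zero =>
    obtain ⟨a, rfl⟩ := X.unit.surjective x
    rw [ψ.toLin_unit, χ.toLin_unit, hhom]
  | succ n ih =>
    -- `dense_mul` is only available for nonzero indices, so the passage from `0` to `1` is supplied
    -- by the hypothesis itself.
    rcases eq_or_ne n 0 with rfl | hn
    · exact hone x
    · refine congrFun (Continuous.ext_on (X.dense_mul hn one_ne_zero) (ψ.continuous_toLin (n + 1))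
        (χ.continuous_toLin (n + 1)) ?_) x
      refine LinearMap.eqOn_span ?_
      rintro _ ⟨y, z, rfl⟩
      rw [ψ.map_mul, χ.map_mul, ih, hone]

end ToeplitzRep

/-- If the universal representation of the fibre at `1` extends to a coisometric representation of
a product system over `ℕ`, then the two relative Cuntz–Pimsner algebras are isomorphic. -/
theorem exists_starAlgEquiv_of_fibreRep_one (X : ProductSystem A ℕ)
    (K : ∀ n, (X.fibre n).CompactIdeal) (ψ : X.ToeplitzRep ((X.fibre 1).CuntzPimsner (K 1)))
    (hψ : ψ.IsCoisometric K) (hψ1 : ψ.fibreRep 1 = (X.fibre 1).cuntzPimsnerRep (K 1)) :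
    ∃ Φ : X.CuntzPimsner K ≃⋆ₐ[ℂ] (X.fibre 1).CuntzPimsner (K 1),
      (∀ x, Φ ((X.cuntzPimsnerRep K).toLin 1 x) = ((X.fibre 1).cuntzPimsnerRep (K 1)).toLin x) ∧
      ∀ a, Φ ((X.cuntzPimsnerRep K).hom a) = ((X.fibre 1).cuntzPimsnerRep (K 1)).hom a := by
  obtain ⟨f, hf⟩ := X.cuntzPimsner_universal K ψ hψ
  obtain ⟨g, hg⟩ := (X.fibre 1).cuntzPimsner_universal (K 1) ((X.cuntzPimsnerRep K).fibreRep 1)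
    (X.cuntzPimsnerRep_isCoisometric K 1)
  have hf1 : ((X.cuntzPimsnerRep K).fibreRep 1).map f = (X.fibre 1).cuntzPimsnerRep (K 1) :=
    (congrArg (fun ρ => ToeplitzRep.fibreRep ρ 1) hf).trans hψ1
  -- `f ∘ g` fixes the universal representation of the fibre at `1`, whose values generate.
  have hfg : f.comp g = NonUnitalStarAlgHom.id ℂ _ :=
    (X.fibre 1).cuntzPimsner_hom_ext (K 1)
      ((congrArg (fun ρ => HilbertBimodule.ToeplitzRep.map ρ f) hg).trans hf1)
  -- `g ∘ f` is only seen to fix the fibre at `1` and `A`; density of products extends this to every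
  -- fibre.
  have hgf : g.comp f = NonUnitalStarAlgHom.id ℂ _ :=
    X.cuntzPimsner_hom_ext K (ToeplitzRep.ext_of_fibreRep_one
      ((congrArg (fun ρ => HilbertBimodule.ToeplitzRep.map ρ g) hf1).trans hg))
  refine ⟨{ f with
    invFun := g
    left_inv := fun z => DFunLike.congr_fun hgf z
    right_inv := fun z => DFunLike.congr_fun hfg z }, fun x => ?_, fun a => ?_⟩
  · exact congrArg (fun ρ => HilbertBimodule.ToeplitzRep.toLin ρ x) hf1
  · exact congrArg (fun ρ => HilbertBimodule.ToeplitzRep.hom ρ a) hf1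

end ProductSystem

/-! ### The multiplier implementing a covariant endomorphism -/

namespace IsHereditaryAction

variable {A : Type u} [NonUnitalCStarAlgebra A] [PartialOrder A] [StarOrderedRing A]

section Multiplier

variable {S : Type v} [AddCommMonoid S] {α : S → A →⋆ₙₐ[ℂ] A} (h : IsHereditaryAction α)

/-- The element `a p_s` of `X_s`. -/
def toFibre (s : S) (a : A) : h.fibre s := ⟨(h.proj s).snd a, a, rfl⟩

theorem toFibre_coe (s : S) (x : h.fibreModule s) : h.toFibre s x = x :=
  Subtype.ext (h.snd_coe x)

/-- Since `α_s(b) = α_s(b) p_s`, the factor `c` may be replaced by `p_s c = (c⋆ p_s)⋆`. For `z ∈ A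
p_s` the product `p_s c z` lies in the range of `α_s`, where `α_s ∘ L_s` is the identity. Thus the
generators of `K_s` act as single rank-one operators. -/
theorem left_eq_theta (s : S) (a b c : A) :
    (h.fibre s).left (a * α s b * c) =
      (h.fibre s).theta (h.toFibre s (a * α s b)) (h.toFibre s (star c)) := by
  refine ContinuousLinearMap.ext fun z => Subtype.ext ?_
  change a * α s b * c * (z : h.fibreModule s).1 =
    (h.proj s).snd (a * α s b) * α s (h.transfer s (star ((h.proj s).snd (star c)) *
      (z : h.fibreModule s).1))
  have hz : α s (h.transfer s (star ((h.proj s).snd (star c)) * (z : h.fibreModule s).1)) =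
      star ((h.proj s).snd (star c)) * (z : h.fibreModule s).1 :=
    h.map_transfer_inner (s := s) (h.toFibre s (star c)) z
  rw [hz, h.star_snd, star_star, h.snd_mul, h.snd_map, ← mul_assoc, mul_assoc a (α s b)
    ((h.proj s).fst c), ← (h.proj s).central, h.snd_map, ← mul_assoc]

/-! ### Nondegeneracy and the implementing multiplier -/

variable {B : Type w} [NonUnitalCStarAlgebra B] {s : S} (ψ : (h.fibre s).ToeplitzRep B)

theorem continuous_toLin : Continuous ψ.toLin :=
  AddMonoidHomClass.continuous_of_bound ψ.toLin 1 fun x => by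
    rw [one_mul]
    exact ψ.norm_toLin_le x

theorem tendsto_hom_mul_toLin {l : Filter A} (hl : l.IsIncreasingApproximateUnit)
    (x : h.fibre s) : Tendsto (fun u => ψ.hom u * ψ.toLin x) l (𝓝 (ψ.toLin x)) := by
  have h1 : Tendsto (fun u => (h.fibre s).left u x) l (𝓝 x) :=
    tendsto_subtype_rng.2 (hl.tendsto_mul_right (x : h.fibreModule s).1)
  exact (((h.continuous_toLin ψ).tendsto x).comp h1).congr fun u => ψ.map_left u x

/-- The right action of `u` is multiplication by `α_s(u)`, which tends strictly to `p_s`, and `x p_s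
= x`. -/
theorem tendsto_toLin_mul_hom {l : Filter A} (hs : StrictTendsto (α s) l (h.proj s))
    (x : h.fibre s) : Tendsto (fun u => ψ.toLin x * ψ.hom u) l (𝓝 (ψ.toLin x)) := by
  have h1 : Tendsto (fun u => (h.fibre s).right x u) l (𝓝 x) := by
    refine tendsto_subtype_rng.2 ?_
    have h2 := (hs (x : h.fibreModule s).1).2
    rw [show (h.proj s).snd (x : h.fibreModule s).1 = _ from h.snd_coe (s := s) x] at h2
    exact h2
  exact (((h.continuous_toLin ψ).tendsto x).comp h1).congr fun u => ψ.map_right x u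

variable {h} in
/-- The representation `(ψ, π)` of `X_s` is nondegenerate along the approximate unit `l`. -/
def IsNondegenerateAlong (l : Filter A) : Prop :=
  ∀ b, Tendsto (fun u => ψ.hom u * b) l (𝓝 b) ∧ Tendsto (fun u => b * ψ.hom u) l (𝓝 b)

/-- The elements on which `π(u)` acts asymptotically as a two-sided unit form a closed
`⋆`-subalgebra, so it suffices to test the generators. For `k(x)` the left limit holds for any
approximate unit; the right one needs `α_s(u) → p_s`. -/
theorem cuntzPimsnerRep_isNondegenerateAlong {l : Filter A} (hl : l.IsIncreasingApproximateUnit)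
    (hs : StrictTendsto (α s) l (h.proj s)) (K : (h.fibre s).CompactIdeal) :
    IsNondegenerateAlong ((h.fibre s).cuntzPimsnerRep K) l := by
  have := hl.neBot
  set k := (h.fibre s).cuntzPimsnerRep K
  have hk1 : ∀ᶠ u in l, ‖k.hom u‖ ≤ 1 := hl.eventually_norm.mono fun u hu =>
    (NonUnitalStarAlgHom.norm_apply_le k.hom u).trans hu
  -- Taking adjoints exchanges the two sides, because `u` is eventually self-adjoint.
  have hstar : ∀ {b c}, Tendsto (fun u => k.hom u * b) l (𝓝 c) →
      Tendsto (fun u => star b * k.hom u) l (𝓝 (star c)) := fun hb => by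
    refine hb.star.congr' ?_
    filter_upwards [hl.eventually_star_eq] with u hu
    rw [star_mul, ← map_star, hu]
  have hstar' : ∀ {b c}, Tendsto (fun u => b * k.hom u) l (𝓝 c) →
      Tendsto (fun u => k.hom u * star b) l (𝓝 (star c)) := fun hb => by
    refine hb.star.congr' ?_
    filter_upwards [hl.eventually_star_eq] with u hu
    rw [star_mul, ← map_star, hu]
  let M : NonUnitalStarSubalgebra ℂ ((h.fibre s).CuntzPimsner K) :=
    { carrier := {b | Tendsto (fun u => k.hom u * b) l (𝓝 b) ∧
        Tendsto (fun u => b * k.hom u) l (𝓝 b)}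
      add_mem' := fun hb hc => ⟨by simpa only [mul_add] using hb.1.add hc.1,
        by simpa only [add_mul] using hb.2.add hc.2⟩
      zero_mem' := ⟨by simp, by simp⟩
      mul_mem' := fun hb hc => ⟨by simpa only [mul_assoc] using hb.1.mul_const _,
        by simpa only [mul_assoc] using hc.2.const_mul _⟩
      smul_mem' := fun c b hb => ⟨by simpa only [mul_smul_comm] using hb.1.const_smul c,
        by simpa only [smul_mul_assoc] using hb.2.const_smul c⟩
      star_mem' := fun hb => ⟨hstar' hb.2, hstar hb.1⟩ }
  refine fun b => (h.fibre s).cuntzPimsner_mem K M ?_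
    (fun x => ⟨h.tendsto_hom_mul_toLin k hl x, h.tendsto_toLin_mul_hom k hs x⟩)
    (fun a => ⟨?_, ?_⟩) b
  · refine isClosed_of_closure_subset fun b hb => ?_
    -- An `ε / 3` argument, valid since multiplication by `π(u)` is eventually contractive.
    have key : ∀ F : A → (h.fibre s).CuntzPimsner K → (h.fibre s).CuntzPimsner K,
        (∀ᶠ u in l, ∀ b c, ‖F u b - F u c‖ ≤ ‖b - c‖) →
        (∀ c ∈ M, Tendsto (fun u => F u c) l (𝓝 c)) → Tendsto (fun u => F u b) l (𝓝 b) := by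
      intro F hF hFM
      rw [Metric.tendsto_nhds]
      intro ε hε
      obtain ⟨c, hc, hbc⟩ := Metric.mem_closure_iff.1 hb (ε / 3) (by positivity)
      filter_upwards [hF, Metric.tendsto_nhds.1 (hFM c hc) (ε / 3) (by positivity)] with u h1 h2
      have h3 := h1 b c
      rw [← dist_eq_norm, ← dist_eq_norm] at h3
      have h4 := dist_triangle4 (F u b) (F u c) c b
      rw [dist_comm c b] at h4
      linarith
    refine ⟨key (fun u b => k.hom u * b) ?_ fun c hc => hc.1,
      key (fun u b => b * k.hom u) ?_ fun c hc => hc.2⟩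
    · filter_upwards [hk1] with u hu b c
      rw [← mul_sub]
      exact (norm_mul_le _ _).trans (mul_le_of_le_one_left (norm_nonneg _) hu)
    · filter_upwards [hk1] with u hu b c
      rw [← sub_mul]
      exact (norm_mul_le _ _).trans (mul_le_of_le_one_right (norm_nonneg _) hu)
  · exact (((continuous_nonUnitalStarAlgHom k.hom).tendsto a).comp
      (hl.tendsto_mul_right a)).congr fun u => map_mul k.hom u a
  · exact (((continuous_nonUnitalStarAlgHom k.hom).tendsto a).comp
      (hl.tendsto_mul_left a)).congr fun u => map_mul k.hom a u

variable {h ψ} in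
theorem IsNondegenerateAlong.eq_of_hom_mul {l : Filter A} [l.NeBot]
    (hψ : IsNondegenerateAlong ψ l) {b c : B} (hbc : ∀ a, ψ.hom a * b = ψ.hom a * c) : b = c :=
  tendsto_nhds_unique (hψ b).1 (by simpa only [hbc] using (hψ c).1)

variable {h ψ} in
theorem IsNondegenerateAlong.eq_of_mul_hom {l : Filter A} [l.NeBot]
    (hψ : IsNondegenerateAlong ψ l) {b c : B} (hbc : ∀ a, b * ψ.hom a = c * ψ.hom a) : b = c :=
  tendsto_nhds_unique (hψ b).2 (by simpa only [hbc] using (hψ c).2)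

variable {h ψ} in
/-- The strict limit `ψ(p_s)` of the elements `ψ(α_s(u))`. -/
theorem IsNondegenerateAlong.exists_multiplier {l : Filter A}
    (hψ : IsNondegenerateAlong ψ l) (hl : l.IsIncreasingApproximateUnit)
    (hs : StrictTendsto (α s) l (h.proj s)) :
    ∃ m : 𝓜(ℂ, B), (∀ a, m.snd (ψ.hom a) = ψ.toLin (h.toFibre s a)) ∧
      ∀ a, m.fst (ψ.hom a) = ψ.toLin (h.toFibre s (α s a)) := by
  have := hl.neBot
  let f : A → B := fun u => ψ.toLin (h.toFibre s (α s u))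
  have hf : ∀ᶠ u in l, ‖f u‖ ≤ 1 := hl.eventually_norm.mono fun u hu => by
    refine (ψ.norm_toLin_le _).trans (le_trans ?_ hu)
    change ‖(h.proj s).snd (α s u)‖ ≤ ‖u‖
    rw [h.snd_map]
    exact NonUnitalStarAlgHom.norm_apply_le (α s) u
  have hleft : ∀ a, Tendsto (fun u => f u * ψ.hom a) l (𝓝 (ψ.toLin (h.toFibre s (α s a)))) := by
    intro a
    have h1 : Tendsto (fun u => (h.fibre s).right (h.toFibre s (α s u)) a) l
        (𝓝 (h.toFibre s (α s a))) := by
      refine tendsto_subtype_rng.2 ?_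
      change Tendsto (fun u => (h.proj s).snd (α s u) * α s a) l (𝓝 ((h.proj s).snd (α s a)))
      simp only [h.snd_map, ← map_mul]
      exact ((h.continuous_map s).tendsto a).comp (hl.tendsto_mul_right a)
    exact (((h.continuous_toLin ψ).tendsto _).comp h1).congr fun u => ψ.map_right _ _
  have hright : ∀ a, Tendsto (fun u => ψ.hom a * f u) l (𝓝 (ψ.toLin (h.toFibre s a))) := by
    intro a
    have h1 : Tendsto (fun u => (h.fibre s).left a (h.toFibre s (α s u))) l
        (𝓝 (h.toFibre s a)) := by
      refine tendsto_subtype_rng.2 ?_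
      change Tendsto (fun u => a * (h.proj s).snd (α s u)) l (𝓝 ((h.proj s).snd a))
      simp only [h.snd_map]
      exact (hs a).2
    exact (((h.continuous_toLin ψ).tendsto _).comp h1).congr fun u => ψ.map_left _ _
  -- Convergence is known against `π(a)`, hence against `π(a) b` and `b π(a)`. Nondegeneracy makes
  -- every `b` a limit of such products, and the set of elements with convergent products is closed.
  obtain ⟨m, hm⟩ := exists_multiplier_of_tendsto f hf
    (fun b => (isClosed_exists_tendsto (fun u b => f u * b) (hf.mono fun u hu b c => by
        rw [← mul_sub]
        exact (norm_mul_le _ _).trans (mul_le_of_le_one_left (norm_nonneg _) hu))).mem_of_tendsto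
      (hψ b).1 (.of_forall fun a => ⟨_, by simpa only [mul_assoc] using (hleft a).mul_const b⟩))
    (fun b => (isClosed_exists_tendsto (fun u b => b * f u) (hf.mono fun u hu b c => by
        rw [← sub_mul]
        exact (norm_mul_le _ _).trans (mul_le_of_le_one_right (norm_nonneg _) hu))).mem_of_tendsto
      (hψ b).2 (.of_forall fun a => ⟨_, by simpa only [mul_assoc] using (hright a).const_mul b⟩))
  exact ⟨m, fun a => tendsto_nhds_unique (hm _).2 (hright a),
    fun a => tendsto_nhds_unique (hm _).1 (hleft a)⟩

/-- The multiplier `m` plays the role of an isometry `S` with `ψ(x) = π(x) S`, for `x ∈ A p_s`, and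
`S π(a) S⋆ = π(α_s(a))`. -/
structure Implements (m : 𝓜(ℂ, B)) : Prop where
  toLin_eq : ∀ x : h.fibreModule s,
    multiplierHom B (ψ.toLin x) = multiplierHom B (ψ.hom x) * m
  mul_hom : ∀ a, m * multiplierHom B (ψ.hom a) = multiplierHom B (ψ.hom (α s a)) * m
  compress : ∀ a, star m * multiplierHom B (ψ.hom (α s a)) * m = multiplierHom B (ψ.hom a)
  conj : ∀ a, m * multiplierHom B (ψ.hom a) * star m = multiplierHom B (ψ.hom (α s a))

-- The multiplier is the strict limit of `ψ(α_s(u))`. Of the relations, only `conj` uses the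
-- coisometry hypothesis `hco`.
variable {h ψ} in
theorem IsNondegenerateAlong.exists_implements {l : Filter A}
    (hψ : IsNondegenerateAlong ψ l) (hl : l.IsIncreasingApproximateUnit)
    (hs : StrictTendsto (α s) l (h.proj s)) (hco : ∀ a b c, ψ.hom (a * α s b * c) =
      ψ.toLin (h.toFibre s (a * α s b)) * star (ψ.toLin (h.toFibre s (star c)))) :
    ∃ m : 𝓜(ℂ, B), Implements h ψ m := by
  have := hl.neBot
  obtain ⟨m, hsnd, hfst⟩ := hψ.exists_multiplier hl hs
  have h1 : ∀ a, multiplierHom B (ψ.toLin (h.toFibre s a)) = multiplierHom B (ψ.hom a) * m :=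
    fun a => by rw [multiplierHom_mul, hsnd]
  have h2 : ∀ a, m * multiplierHom B (ψ.hom a) = multiplierHom B (ψ.hom (α s a)) * m :=
    fun a => by rw [mul_multiplierHom, hfst, h1]
  have h3 : ∀ a, star m * multiplierHom B (ψ.hom (α s a)) * m = multiplierHom B (ψ.hom a) := by
    intro c
    rw [mul_assoc, ← h1, mul_multiplierHom]
    congr 1
    -- After multiplication by `π(d)` on the left, `π(d) m⋆ = (m π(d⋆))⋆ = ψ(α_s(d⋆))⋆`, so the
    -- claim becomes the inner product identity `⟨α_s(d⋆), α_s(c)⟩ = d c`.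
    refine hψ.eq_of_hom_mul fun d => multiplierHom_injective ?_
    have h4 : star (ψ.toLin (h.toFibre s (α s (star d)))) * ψ.toLin (h.toFibre s (α s c)) =
        ψ.hom (d * c) := by
      rw [ψ.map_inner]
      congr 1
      refine h.injective s ((h.map_transfer_inner (s := s) (h.toFibre s (α s (star d)))
        (h.toFibre s (α s c))).trans ?_)
      change star ((h.proj s).snd (α s (star d))) * (h.proj s).snd (α s c) = _
      rw [h.snd_map, h.snd_map, map_star, star_star, map_mul]
    rw [map_mul, ← mul_multiplierHom, ← map_mul ψ.hom, ← h4, map_mul, map_star, ← mul_assoc]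
    congr 1
    rw [h1, ← h2, star_mul, ← map_star, ← map_star, star_star]
  refine ⟨m, fun x => ?_, h2, h3, fun b => ?_⟩
  · rw [← h1, h.toFibre_coe]
  · rw [mul_multiplierHom, multiplierHom_mul]
    congr 1
    -- Between `π(a)` and `π(c)`, both sides equal `π(a α_s(b) c)`: by `hco` it is `π(a α_s(b)) m m⋆
    -- π(c)`, and `π(α_s(b)) m = m π(b)`.
    refine hψ.eq_of_mul_hom fun c => hψ.eq_of_hom_mul fun a => multiplierHom_injective ?_
    rw [← map_mul ψ.hom, ← map_mul ψ.hom, ← mul_assoc, ← mul_assoc, hco, map_mul, map_mul, map_mul, map_star,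
      h1, h1, ← multiplierHom_mul, ← mul_multiplierHom, h2, star_mul, ← map_star, ← map_star,
      star_star, map_mul ψ.hom, map_mul]
    simp only [mul_assoc]

end Multiplier

/-! ### Extending representations of `X_1` to the product system over `ℕ` -/

section Powers

variable {α : ℕ → A →⋆ₙₐ[ℂ] A} {h : IsHereditaryAction α} {B : Type w} [NonUnitalCStarAlgebra B]
  {ψ : (h.fibre 1).ToeplitzRep B} {m : 𝓜(ℂ, B)}

theorem Implements.pow_mul_hom (hm : Implements h ψ m) (n : ℕ) (a : A) :
    m ^ n * multiplierHom B (ψ.hom a) = multiplierHom B (ψ.hom (α n a)) * m ^ n := by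
  induction n generalizing a with
  | zero => simp [h.map_zero]
  | succ n ih => rw [pow_succ, mul_assoc, hm.mul_hom, ← mul_assoc, ih, h.map_add_apply, mul_assoc]

theorem Implements.pow_compress (hm : Implements h ψ m) (n : ℕ) (a : A) :
    star (m ^ n) * multiplierHom B (ψ.hom (α n a)) * m ^ n = multiplierHom B (ψ.hom a) := by
  induction n generalizing a with
  | zero => simp [h.map_zero]
  | succ n ih =>
    calc star (m ^ (n + 1)) * multiplierHom B (ψ.hom (α (n + 1) a)) * m ^ (n + 1)
        = star m * (star (m ^ n) * multiplierHom B (ψ.hom (α n (α 1 a))) * m ^ n) * m := by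
          rw [pow_succ, star_mul, h.map_add_apply]
          simp only [mul_assoc]
      _ = multiplierHom B (ψ.hom a) := by rw [ih, hm.compress]

/-- The identity for `m` nests, `α_n` being applied outside `α_1`. This is where coisometry passes
from `K_1` to all `K_n`. -/
theorem Implements.pow_conj (hm : Implements h ψ m) (n : ℕ) (a : A) :
    m ^ n * multiplierHom B (ψ.hom a) * star (m ^ n) = multiplierHom B (ψ.hom (α n a)) := by
  induction n generalizing a with
  | zero => simp [h.map_zero]
  | succ n ih =>
    calc m ^ (n + 1) * multiplierHom B (ψ.hom a) * star (m ^ (n + 1))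
        = m ^ n * (m * multiplierHom B (ψ.hom a) * star m) * star (m ^ n) := by
          rw [pow_succ, star_mul]
          simp only [mul_assoc]
      _ = multiplierHom B (ψ.hom (α (n + 1) a)) := by rw [hm.conj, ih, h.map_add_apply]

variable (h ψ m) in
/-- The map `x ↦ π(x) m ^ n` on `X_n`. -/
def powLin (n : ℕ) : h.fibreModule n →ₗ[ℂ] B :=
  ((m ^ n).snd : B →ₗ[ℂ] B) ∘ₗ (ψ.hom : A →ₗ[ℂ] B) ∘ₗ (h.fibreModule n).subtype

theorem multiplierHom_powLin (n : ℕ) (x : h.fibreModule n) :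
    multiplierHom B (powLin h ψ m n x) = multiplierHom B (ψ.hom x) * m ^ n :=
  (multiplierHom_mul _ _).symm

theorem powLin_zero (x : h.fibreModule 0) : powLin h ψ m 0 x = ψ.hom x :=
  multiplierHom_injective (by rw [multiplierHom_powLin, pow_zero, mul_one])

/-- The hypothesis compares underlying elements of `A`, so that here and in the next lemmas it holds
by `rfl` for the operations of the product system. -/
theorem powLin_left (n : ℕ) (a : A) (x y : h.fibreModule n) (hy : (y : A) = a * x) :
    powLin h ψ m n y = ψ.hom a * powLin h ψ m n x :=
  multiplierHom_injective (by
    rw [multiplierHom_powLin, hy, map_mul, map_mul, map_mul, multiplierHom_powLin, mul_assoc])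

theorem Implements.powLin_mul (hm : Implements h ψ m) {n k : ℕ} (x : h.fibreModule n)
    (y : h.fibreModule k) (z : h.fibreModule (n + k)) (hz : (z : A) = x * α n y) :
    powLin h ψ m (n + k) z = powLin h ψ m n x * powLin h ψ m k y :=
  multiplierHom_injective (by
    rw [map_mul, multiplierHom_powLin, multiplierHom_powLin, multiplierHom_powLin, hz, map_mul,
      map_mul, pow_add, mul_assoc (multiplierHom B (ψ.hom x)) (m ^ n), ← mul_assoc (m ^ n),
      hm.pow_mul_hom]
    simp only [mul_assoc])

theorem Implements.powLin_right (hm : Implements h ψ m) (n : ℕ) (x y : h.fibreModule n) (a : A)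
    (hy : (y : A) = x * α n a) : powLin h ψ m n y = powLin h ψ m n x * ψ.hom a :=
  multiplierHom_injective (by
    rw [map_mul, multiplierHom_powLin, multiplierHom_powLin, hy, map_mul, map_mul, mul_assoc,
      mul_assoc, hm.pow_mul_hom])

theorem Implements.star_powLin_mul (hm : Implements h ψ m) (n : ℕ) (x y : h.fibreModule n) :
    star (powLin h ψ m n x) * powLin h ψ m n y = ψ.hom (h.transfer n (star (x : A) * y)) :=
  multiplierHom_injective (by
    -- `π(L_n(x⋆ y))` is rewritten as the compression of `π(α_n(L_n(x⋆ y))) = π(x⋆ y)` by `m ^ n`.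
    rw [← hm.pow_compress n, h.map_transfer_inner, map_mul, map_star, multiplierHom_powLin,
      multiplierHom_powLin, star_mul, map_mul, map_mul, map_star, map_star]
    simp only [mul_assoc])

/-- The representation `x ↦ π(x) m ^ n`, for `x ∈ X_n`, of the product system. -/
def Implements.powRep (hm : Implements h ψ m) : h.productSystem.ToeplitzRep B where
  toLin := powLin h ψ m
  hom := ψ.hom
  toLin_unit a := powLin_zero ⟨a, h.proj_zero_snd a⟩
  map_mul x y := hm.powLin_mul x y ⟨_, h.mul_map_mem x y⟩ rfl
  map_right n x a := hm.powLin_right n x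
    ⟨_, h.mul_mem_fibreModule _ (h.map_mem_fibreModule n a)⟩ a rfl
  map_inner n x y := hm.star_powLin_mul n x y
  map_left n a x := powLin_left n a x ⟨_, h.mul_mem_fibreModule a x.2⟩ rfl

theorem Implements.powRep_fibreRep_one (hm : Implements h ψ m) : hm.powRep.fibreRep 1 = ψ := by
  refine HilbertBimodule.ToeplitzRep.ext (LinearMap.ext fun x => multiplierHom_injective ?_) rfl
  refine (multiplierHom_powLin 1 x).trans ?_
  rw [pow_one]
  exact (hm.toLin_eq x).symm

/-! ### Coisometry on the ideals `K_n` -/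

theorem isCoisometric_of_hom_eq {S : Type v} [AddCommMonoid S] {β : S → A →⋆ₙₐ[ℂ] A}
    {h : IsHereditaryAction β} {s : S} (ψ : (h.fibre s).ToeplitzRep B)
    (hco : ∀ a b c, ψ.hom (a * β s b * c) =
      ψ.toLin (h.toFibre s (a * β s b)) * star (ψ.toLin (h.toFibre s (star c)))) :
    ψ.IsCoisometric (h.ideal s) := by
  intro a ha
  refine (ψ.compactMap_eq_iff _ _).2 ?_
  have hc : Continuous (h.fibre s).left :=
    AddMonoidHomClass.continuous_of_bound (h.fibre s).left 1 fun a => by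
      rw [one_mul]
      exact ContinuousLinearMap.opNorm_le_bound _ (norm_nonneg _) fun x =>
        norm_mul_le a (x : h.fibreModule s).1
  let F : A →ₗ[ℂ] ((h.fibre s →L[ℂ] h.fibre s) × B) :=
    LinearMap.prod ((h.fibre s).left : A →ₗ[ℂ] _) (ψ.hom : A →ₗ[ℂ] B)
  have hF : Continuous F := hc.prodMk (continuous_nonUnitalStarAlgHom ψ.hom)
  -- The pair `(φ(a), π(a))` depends linearly and continuously on `a` and lies in the graph of
  -- `ψ⁽¹⁾` for the generators of `K_s`; hence it lies in the closed graph for all of `K_s`.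
  have hle : Submodule.span ℂ {x | ∃ a b c, x = a * β s b * c} ≤ ψ.graph.comap F := by
    refine Submodule.span_le.2 ?_
    rintro _ ⟨a, b, c, rfl⟩
    exact Submodule.subset_span ⟨_, _, Prod.ext (h.left_eq_theta s a b c) (hco a b c)⟩
  exact map_mem_closure (f := F) hF ha fun p hp => hle hp

theorem hom_eq_of_isCoisometric {S : Type v} [AddCommMonoid S] {β : S → A →⋆ₙₐ[ℂ] A}
    {h : IsHereditaryAction β} {s : S} (ψ : (h.fibre s).ToeplitzRep B)
    (hψ : ψ.IsCoisometric (h.ideal s)) (a b c : A) : ψ.hom (a * β s b * c) =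
      ψ.toLin (h.toFibre s (a * β s b)) * star (ψ.toLin (h.toFibre s (star c))) := by
  have ha : a * β s b * c ∈ (h.ideal s).carrier :=
    Submodule.le_topologicalClosure _ (Submodule.subset_span ⟨a, b, c, rfl⟩)
  rw [← ψ.compactMap_theta, ← hψ _ ha]
  exact congrArg ψ.compactMap (Subtype.ext (h.left_eq_theta s a b c))

theorem Implements.powLin_mul_star (hm : Implements h ψ m) (n : ℕ) (a b c : A)
    (x y : h.fibreModule n) (hx : (x : A) = (h.proj n).snd (a * α n b))
    (hy : (y : A) = (h.proj n).snd (star c)) :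
    ψ.hom (a * α n b * c) = powLin h ψ m n x * star (powLin h ψ m n y) :=
  multiplierHom_injective (by
    have h1 : a * α n b * c = a * (α n b * (h.proj n).fst c) := by
      rw [← (h.proj n).central, h.snd_map, mul_assoc]
    have h2 := hm.pow_conj n b
    -- Now `h2` says `π(α_n(b)) m ^ n (m ^ n)⋆ = π(α_n(b))`, which lets `m ^ n (m ^ n)⋆` be inserted
    -- between `α_n(b)` and `p_n c`.
    rw [hm.pow_mul_hom] at h2
    rw [map_mul (multiplierHom B), map_star, multiplierHom_powLin, multiplierHom_powLin, hx, hy, h1,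
      h.snd_mul, h.snd_map, star_mul, ← map_star, ← map_star, h.star_snd, star_star]
    simp only [map_mul]
    conv_lhs => rw [← h2]
    simp only [mul_assoc])

theorem Implements.powRep_isCoisometric (hm : Implements h ψ m) :
    hm.powRep.IsCoisometric h.ideal := fun n =>
  isCoisometric_of_hom_eq (hm.powRep.fibreRep n) fun a b c =>
    hm.powLin_mul_star n a b c (h.toFibre n (a * α n b)) (h.toFibre n (star c)) rfl rfl

end Powers

end IsHereditaryAction

end RelCP

end

theorem mainTheorem4 {A : Type*} [NonUnitalCStarAlgebra A] [PartialOrder A] [StarOrderedRing A]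
    (α : ℕ → A →⋆ₙₐ[ℂ] A) (h : RelCP.IsHereditaryAction α) :
    ∃ Φ : h.productSystem.CuntzPimsner h.ideal ≃⋆ₐ[ℂ]
        (h.productSystem.fibre 1).CuntzPimsner (h.ideal 1),
      (∀ x, Φ ((h.productSystem.cuntzPimsnerRep h.ideal).toLin 1 x) =
        ((h.productSystem.fibre 1).cuntzPimsnerRep (h.ideal 1)).toLin x) ∧
      ∀ a, Φ ((h.productSystem.cuntzPimsnerRep h.ideal).hom a) =
        ((h.productSystem.fibre 1).cuntzPimsnerRep (h.ideal 1)).hom a := by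
  -- One approximate unit with `α_1(u) → p_1` strictly serves both for the nondegeneracy of the
  -- universal representation and for the definition of `m`.
  obtain ⟨l, hl, hs⟩ := h.exists_approx 1
  obtain ⟨m, hm⟩ := (h.cuntzPimsnerRep_isNondegenerateAlong hl hs (h.ideal 1)).exists_implements
    hl hs (RelCP.IsHereditaryAction.hom_eq_of_isCoisometric _
      ((h.productSystem.fibre 1).cuntzPimsnerRep_isCoisometric (h.ideal 1)))
  exact h.productSystem.exists_starAlgEquiv_of_fibreRep_one h.ideal hm.powRep
    hm.powRep_isCoisometric hm.powRep_fibreRep_one
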